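/- Let $K$ be a field and let $X_\bullet:(\mathbb R,\le)\to\mathrm{Top}$ be a persistent space, i.e. a functor from the poset $(\mathbb R,\le)$ to topological spaces. Write $H^*(X_t)=\bigoplus_{p\ge 0}H^p(X_t)$ for the singular cohomology ring with coefficients in $K$ and the cup product, and $H^+(X_t)=\bigoplus_{p\ge 1}H^p(X_t)$. For $a\le b$, the persistent cup-length $\mathbf{cup}(X_\bullet)([a,b])\in\mathbb N\cup\{\infty\}$ is the supremum of all $\ell\ge 0$ for which there are $\ell$ homogeneous elements of positive degree in the image ring $\operatorname{im}(H^*(X_b)\to H^*(X_a))$ with non-zero product. For $\ell\ge 1$, the persistent $\ell$-cup module $\Phi^\ell(X_\bullet)$ is the contravariant persistent graded vector space $t\mapsto (H^+(X_t))^\ell$, where $(H^+(X_t))^\ell$ is the (non-unital) subalgebra generated by all $\ell$-fold products of elements of $H^+(X_t)$. An interval is a non-empty order-connected subset $J\subseteq\mathbb R$ (its endpoints may be open, closed or infinite), and its interval module $K_J$ is the contravariant persistence module that is $K$ on $J$ and $0$ elsewhere, with identity maps inside $J$. A barcode of a persistence module $M$ is a family of intervals $(J_l)_{l\in L}$ with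 $M\cong\bigoplus_{l\in L}K_{J_l}$. Whenever the degree-$p$ components $\deg_p\Phi^\ell(X_\bullet)$ have barcodes, put $\mathbf{barc}(\Phi^\ell(X_\bullet))=\bigsqcup_{p\ge1}\mathbf{barc}(\deg_p\Phi^\ell(X_\bullet))$. All suprema below are taken in $\mathbb N\cup\{\infty\}$ with $\sup\emptyset=0$; a supremum is a maximum whenever it is finite and the set is non-empty. 1. Suppose that $X_\bullet$ has q-tame persistent cohomology (for every $p$ and all $s<t$ the map $H^p(X_t)\to H^p(X_s)$ has finite rank) and that its set of critical values is discrete, where $t$ is critical if no neighbourhood $(t-\varepsilon,t+\varepsilon)$ exists in which all maps $H^*(X_{s'})\to H^*(X_s)$, $s\le s'$, are bijective. Then $\deg_p\Phi^\ell(X_\bullet)$ has a barcode for all $\ell,p\ge 1$. 2. For every persistent space $X_\bullet$ for which all $\deg_p\Phi^\ell(X_\bullet)$, $\ell,p\geq 1$, have barcodes, for every choice of barcodes, and for all $a\le b$, $$\mathbf{cup}(X_\bullet)([a,b])=\sup_{J\supseteq[a,b]}\ \sup\{\ell\ge 1 : J\in\mathbf{barc}(\Phi^\ell(X_\bullet))\},$$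 where $J$ ranges over the intervals that contain $[a,b]$. 3. The map $J\mapsto\sup\{\ell\ge1 : J\in\mathbf{barc}(\Phi^\ell(X_\bullet))\}$ does not depend on the chosen decompositions into interval modules (in particular, not on a choice of representative cocycles). -/

import Mathlib

open CategoryTheory

universe u v w

noncomputable section

open Opposite
open scoped Simplicial DirectSum

namespace CupPersistence

/-! ### Cochains of a simplicial set, coboundary and cup product -/

/-- The `n`-cochains of a simplicial set with coefficients in `K`. -/
abbrev Cochain (K : Type v) (S : SSet.{u}) (n : ℕ) : Type (max u v) := S _⦋n⦌ → K

/-- The inclusion `⦋p⦌ ⟶ ⦋n⦌` of the first `p + 1` vertices. -/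
def front (p n : ℕ) (h : p ≤ n) : ⦋p⦌ ⟶ ⦋n⦌ :=
  SimplexCategory.mkHom
    { toFun := fun i => ⟨i.val, by have := i.isLt; omega⟩
      monotone' := fun _ _ hij => hij }

/-- The inclusion `⦋q⦌ ⟶ ⦋n⦌` of the last `q + 1` vertices, where `p + q = n`. -/
def back (p q n : ℕ) (h : p + q = n) : ⦋q⦌ ⟶ ⦋n⦌ :=
  SimplexCategory.mkHom
    { toFun := fun i => ⟨p + i.val, by have := i.isLt; omega⟩
      monotone' := fun _ _ hij => Nat.add_le_add_left hij p }

section Cochains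

variable (K : Type v) [Field K]

/-- The coboundary `(δ f)(σ) = ∑ i, (-1)^i f(d_i σ)`. -/
def coboundary (S : SSet.{u}) (n : ℕ) : Cochain K S n →ₗ[K] Cochain K S (n + 1) where
  toFun f := fun σ => ∑ i : Fin (n + 2), (-1 : K) ^ (i : ℕ) * f (S.δ i σ)
  map_add' f g := by
    funext σ
    simp [mul_add, Finset.sum_add_distrib]
  map_smul' c f := by
    funext σ
    simp only [Pi.smul_apply, smul_eq_mul, RingHom.id_apply, Finset.mul_sum]
    exact Finset.sum_congr rfl fun i _ => by ring

/-- The Alexander–Whitney cup product of cochains, `p + q = n`: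
`(f ⌣ g)[x₀, …, xₙ] = f[x₀, …, x_p] * g[x_p, …, xₙ]`. -/
def cupCochain (S : SSet.{u}) {p q n : ℕ} (h : p + q = n) :
    Cochain K S p →ₗ[K] Cochain K S q →ₗ[K] Cochain K S n :=
  LinearMap.mk₂ K
    (fun f g σ => f (S.map (front p n (by omega)).op σ) * g (S.map (back p q n h).op σ))
    (fun f f' g => by funext σ; simp [add_mul])
    (fun c f g => by funext σ; simp [mul_assoc])
    (fun f g g' => by funext σ; simp [mul_add])
    (fun c f g => by funext σ; simp [mul_left_comm])

variable {K}

@[simp]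
theorem cupCochain_apply (S : SSet.{u}) {p q n : ℕ} (h : p + q = n) (f : Cochain K S p)
    (g : Cochain K S q) (σ : S _⦋n⦌) :
    cupCochain K S h f g σ =
      f (S.map (front p n (by omega)).op σ) * g (S.map (back p q n h).op σ) := rfl

@[simp]
theorem coboundary_apply (S : SSet.{u}) (n : ℕ) (f : Cochain K S n) (σ : S _⦋n + 1⦌) :
    coboundary K S n f σ = ∑ i : Fin (n + 2), (-1 : K) ^ (i : ℕ) * f (S.δ i σ) := rfl

theorem map_map_op (S : SSet.{u}) {a b c : ℕ} (α : ⦋a⦌ ⟶ ⦋b⦌) (β : ⦋b⦌ ⟶ ⦋c⦌) (σ : S _⦋c⦌) :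
    S.map α.op (S.map β.op σ) = S.map (α ≫ β).op σ := by
  simp

theorem cupCochain_assoc (S : SSet.{u}) {p q r k l n : ℕ} (h₁ : p + q = k) (h₂ : k + r = n)
    (h₃ : q + r = l) (h₄ : p + l = n) (f : Cochain K S p) (g : Cochain K S q)
    (e : Cochain K S r) :
    cupCochain K S h₂ (cupCochain K S h₁ f g) e = cupCochain K S h₄ f (cupCochain K S h₃ g e) := by
  funext σ
  simp only [cupCochain_apply, map_map_op, mul_assoc]
  have e1 : front p k (by omega) ≫ front k n (by omega) = front p n (by omega) := rfl
  have e2 : back p q k h₁ ≫ front k n (by omega) = front q l (by omega) ≫ back p l n h₄ := rfl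
  have e3 : back q r l h₃ ≫ back p l n h₄ = back k r n h₂ := by
    ext i
    change p + (q + i.val) = k + i.val
    omega
  rw [e1, e2, e3]

/-- The face `⦋n⦌ ⟶ ⦋n + 1⦌` that skips the vertex `i`, with a natural number as index. -/
def natFace (n i : ℕ) : ⦋n⦌ ⟶ ⦋n + 1⦌ :=
  SimplexCategory.mkHom
    { toFun := fun j => ⟨if j.val < i then j.val else j.val + 1, by
        have := j.isLt
        split_ifs <;> omega⟩
      monotone' := fun a b hab => by
        have : a.val ≤ b.val := hab
        change (if a.val < i then a.val else a.val + 1) ≤ (if b.val < i then b.val else b.val + 1)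
        split_ifs <;> omega }

theorem natFace_eq (n : ℕ) (i : Fin (n + 2)) : SimplexCategory.δ i = natFace n i.val := by
  ext j
  change ((Fin.succAbove i j : Fin (n + 2)) : ℕ) = if j.val < i.val then j.val else j.val + 1
  simp only [Fin.succAbove, Fin.lt_def, Fin.val_castSucc]
  split_ifs <;> simp

theorem coboundary_apply' (S : SSet.{u}) (n : ℕ) (f : Cochain K S n) (σ : S _⦋n + 1⦌) :
    coboundary K S n f σ =
      ∑ i ∈ Finset.range (n + 2), (-1 : K) ^ i * f (S.map (natFace n i).op σ) := by
  rw [coboundary_apply, Finset.sum_range]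
  refine Finset.sum_congr rfl fun i _ => ?_
  rw [SimplicialObject.δ_def, natFace_eq]

/-- The Leibniz rule `δ(f ⌣ g) = δf ⌣ g + (-1)^p f ⌣ δg`. -/
theorem coboundary_cupCochain (S : SSet.{u}) {p q n : ℕ} (h : p + q = n) (f : Cochain K S p)
    (g : Cochain K S q) :
    coboundary K S n (cupCochain K S h f g) =
      cupCochain K S (p := p + 1) (q := q) (n := n + 1) (by omega) (coboundary K S p f) g +
        (-1 : K) ^ p • cupCochain K S (p := p) (q := q + 1) (n := n + 1) (by omega) f
          (coboundary K S q g) := by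
  funext σ
  have a1 : ∀ i, i ≤ p → front p n (by omega) ≫ natFace n i =
      natFace p i ≫ front (p + 1) (n + 1) (by omega) := fun _ _ => rfl
  have a2 : ∀ i, i ≤ p → back p q n h ≫ natFace n i = back (p + 1) q (n + 1) (by omega) := by
    intro i hi
    ext j
    change (if p + j.val < i then p + j.val else p + j.val + 1) = p + 1 + j.val
    split_ifs <;> omega
  have b1 : ∀ i, front p n (by omega) ≫ natFace n (p + 1 + i) =
      front p (n + 1) (by omega) := by
    intro i
    ext j
    change (if j.val < p + 1 + i then j.val else j.val + 1) = j.val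
    have : j.val < p + 1 := j.isLt
    rw [if_pos (by omega)]
  have b2 : ∀ i, back p q n h ≫ natFace n (p + 1 + i) =
      natFace q (i + 1) ≫ back p (q + 1) (n + 1) (by omega) := by
    intro i
    ext j
    change (if p + j.val < p + 1 + i then p + j.val else p + j.val + 1) =
      p + (if j.val < i + 1 then j.val else j.val + 1)
    split_ifs <;> omega
  have c1 : natFace p (p + 1) ≫ front (p + 1) (n + 1) (by omega) =
      front p (n + 1) (by omega) := by
    ext j
    change (if j.val < p + 1 then j.val else j.val + 1) = j.val
    exact if_pos j.isLt
  have c2 : natFace q 0 ≫ back p (q + 1) (n + 1) (by omega) =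
      back (p + 1) q (n + 1) (by omega) := by
    ext j
    change p + (if j.val < 0 then j.val else j.val + 1) = p + 1 + j.val
    split_ifs <;> omega
  have hn : n + 2 = (p + 1) + (q + 1) := by omega
  simp only [Pi.add_apply, Pi.smul_apply, smul_eq_mul, cupCochain_apply, coboundary_apply',
    map_map_op]
  rw [hn, Finset.sum_range_add, Finset.sum_range_succ (n := p + 1),
    Finset.sum_range_succ' (n := q + 1)]
  simp only [c1, c2, b1, b2]
  have h1 : ∑ i ∈ Finset.range (p + 1), (-1 : K) ^ i *
        (f (S.map (front p n (by omega) ≫ natFace n i).op σ) *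
          g (S.map (back p q n h ≫ natFace n i).op σ)) =
      (∑ i ∈ Finset.range (p + 1), (-1 : K) ^ i *
        f (S.map (natFace p i ≫ front (p + 1) (n + 1) (by omega)).op σ)) *
        g (S.map (back (p + 1) q (n + 1) (by omega)).op σ) := by
    rw [Finset.sum_mul]
    refine Finset.sum_congr rfl fun i hi => ?_
    have hi' : i ≤ p := by
      have := Finset.mem_range.1 hi
      omega
    rw [a1 i hi', a2 i hi', mul_assoc]
  have h2 : ∑ i ∈ Finset.range (q + 1), (-1 : K) ^ (p + 1 + i) *
        (f (S.map (front p (n + 1) (by omega)).op σ) *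
          g (S.map (natFace q (i + 1) ≫ back p (q + 1) (n + 1) (by omega)).op σ)) =
      (-1 : K) ^ p * (f (S.map (front p (n + 1) (by omega)).op σ) *
        ∑ i ∈ Finset.range (q + 1), (-1 : K) ^ (i + 1) *
          g (S.map (natFace q (i + 1) ≫ back p (q + 1) (n + 1) (by omega)).op σ)) := by
    simp only [Finset.mul_sum]
    exact Finset.sum_congr rfl fun i _ => by ring
  rw [h1, h2]
  ring

/-- The unit cochain, constant with value `1`. -/
def oneCochain (K : Type v) [Field K] (S : SSet.{u}) : Cochain K S 0 := fun _ => 1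

theorem coboundary_oneCochain (S : SSet.{u}) : coboundary K S 0 (oneCochain K S) = 0 := by
  funext σ
  simp [oneCochain, Fin.sum_univ_two]

theorem one_cupCochain (S : SSet.{u}) {p : ℕ} (h : 0 + p = p) (f : Cochain K S p) :
    cupCochain K S h (oneCochain K S) f = f := by
  funext σ
  have e : back 0 p p h = 𝟙 _ := by
    ext j
    change 0 + j.val = j.val
    omega
  rw [cupCochain_apply, e]
  simp [oneCochain]

theorem cupCochain_one (S : SSet.{u}) {p : ℕ} (h : p + 0 = p) (f : Cochain K S p) :
    cupCochain K S h f (oneCochain K S) = f := by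
  funext σ
  have e : front p p (by omega) = 𝟙 _ := rfl
  rw [cupCochain_apply, e]
  simp [oneCochain]

variable (K) in
/-- Pullback of cochains along a map of simplicial sets. -/
def cochainMap {S T : SSet.{u}} (φ : S ⟶ T) (n : ℕ) : Cochain K T n →ₗ[K] Cochain K S n where
  toFun f := fun σ => f (φ.app (op ⦋n⦌) σ)
  map_add' _ _ := rfl
  map_smul' _ _ := rfl

theorem cochainMap_apply {S T : SSet.{u}} (φ : S ⟶ T) (n : ℕ) (f : Cochain K T n)
    (σ : S _⦋n⦌) : cochainMap K φ n f σ = f (φ.app (op ⦋n⦌) σ) := rfl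

theorem app_map {S T : SSet.{u}} (φ : S ⟶ T) {a b : ℕ} (α : ⦋a⦌ ⟶ ⦋b⦌) (σ : S _⦋b⦌) :
    φ.app (op ⦋a⦌) (S.map α.op σ) = T.map α.op (φ.app (op ⦋b⦌) σ) :=
  NatTrans.naturality_apply φ α.op σ

theorem coboundary_cochainMap {S T : SSet.{u}} (φ : S ⟶ T) (n : ℕ) (f : Cochain K T n) :
    coboundary K S n (cochainMap K φ n f) = cochainMap K φ (n + 1) (coboundary K T n f) := by
  funext σ
  simp only [coboundary_apply', cochainMap_apply, app_map]

theorem cochainMap_cup {S T : SSet.{u}} (φ : S ⟶ T) {p q n : ℕ} (h : p + q = n)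
    (f : Cochain K T p) (g : Cochain K T q) :
    cochainMap K φ n (cupCochain K T h f g) =
      cupCochain K S h (cochainMap K φ p f) (cochainMap K φ q g) := by
  funext σ
  simp only [cupCochain_apply, cochainMap_apply, app_map]

end Cochains

/-! ### The cohomology algebra -/

section Cohomology

variable (K : Type v) [Field K]

/-- The cocycles of degree `n`. -/
def cocycles (S : SSet.{u}) (n : ℕ) : Submodule K (Cochain K S n) :=
  LinearMap.ker (coboundary K S n)

/-- The coboundaries of degree `n`; there are none but `0` in degree `0`. -/
def coboundaries (S : SSet.{u}) (n : ℕ) : Submodule K (Cochain K S n) :=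
  match n with
  | 0 => ⊥
  | n + 1 => LinearMap.range (coboundary K S n)

/-- The `n`-th cohomology `Zⁿ / Bⁿ` of a simplicial set. -/
def Coh (S : SSet.{u}) (n : ℕ) : Type (max u v) :=
  cocycles K S n ⧸ (coboundaries K S n).submoduleOf (cocycles K S n)

instance (S : SSet.{u}) (n : ℕ) : AddCommGroup (Coh K S n) :=
  inferInstanceAs (AddCommGroup
    (cocycles K S n ⧸ (coboundaries K S n).submoduleOf (cocycles K S n)))

instance (S : SSet.{u}) (n : ℕ) : Module K (Coh K S n) :=
  inferInstanceAs (Module K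
    (cocycles K S n ⧸ (coboundaries K S n).submoduleOf (cocycles K S n)))

/-- The cohomology class of a cocycle. -/
def cohClass (S : SSet.{u}) (n : ℕ) : cocycles K S n →ₗ[K] Coh K S n :=
  ((coboundaries K S n).submoduleOf (cocycles K S n)).mkQ

theorem cohClass_surjective (S : SSet.{u}) (n : ℕ) : Function.Surjective (cohClass K S n) :=
  Submodule.mkQ_surjective _

theorem cohClass_eq_zero (S : SSet.{u}) (n : ℕ) (z : cocycles K S n) :
    cohClass K S n z = 0 ↔ (z : Cochain K S n) ∈ coboundaries K S n :=
  (Submodule.Quotient.mk_eq_zero _).trans Iff.rfl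

theorem cup_mem_cocycles (S : SSet.{u}) {p q n : ℕ} (h : p + q = n) (f : cocycles K S p)
    (g : cocycles K S q) :
    cupCochain K S h (f : Cochain K S p) (g : Cochain K S q) ∈ cocycles K S n := by
  have hf : coboundary K S p (f : Cochain K S p) = 0 := f.2
  have hg : coboundary K S q (g : Cochain K S q) = 0 := g.2
  change coboundary K S n _ = 0
  rw [coboundary_cupCochain, hf, hg]
  simp

theorem cup_mem_coboundaries_left (S : SSet.{u}) {p q n : ℕ} (h : p + q = n)
    (f : Cochain K S p) (hf : f ∈ coboundaries K S p) (g : cocycles K S q) :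
    cupCochain K S h f (g : Cochain K S q) ∈ coboundaries K S n := by
  have hg : coboundary K S q (g : Cochain K S q) = 0 := g.2
  cases p with
  | zero =>
    have hf0 : f = 0 := hf
    rw [hf0, map_zero, LinearMap.zero_apply]
    exact Submodule.zero_mem _
  | succ p =>
    obtain ⟨e, rfl⟩ := hf
    obtain ⟨m, rfl⟩ : ∃ m, n = m + 1 := ⟨p + q, by omega⟩
    refine ⟨cupCochain K S (p := p) (q := q) (n := m) (by omega) e g, ?_⟩
    rw [coboundary_cupCochain, hg]
    simp

theorem cup_mem_coboundaries_right (S : SSet.{u}) {p q n : ℕ} (h : p + q = n)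
    (f : cocycles K S p) (g : Cochain K S q) (hg : g ∈ coboundaries K S q) :
    cupCochain K S h (f : Cochain K S p) g ∈ coboundaries K S n := by
  have hf : coboundary K S p (f : Cochain K S p) = 0 := f.2
  cases q with
  | zero =>
    have hg0 : g = 0 := hg
    rw [hg0, map_zero]
    exact Submodule.zero_mem _
  | succ q =>
    obtain ⟨e, rfl⟩ := hg
    obtain ⟨m, rfl⟩ : ∃ m, n = m + 1 := ⟨p + q, by omega⟩
    refine ⟨(-1 : K) ^ p • cupCochain K S (p := p) (q := q) (n := m) (by omega) f e, ?_⟩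
    rw [map_smul, coboundary_cupCochain, hf, map_zero, LinearMap.zero_apply, zero_add, smul_smul,
      ← mul_pow]
    simp

/-- The cup product of cocycles. -/
def cupCocycle (S : SSet.{u}) {p q n : ℕ} (h : p + q = n) :
    cocycles K S p →ₗ[K] cocycles K S q →ₗ[K] cocycles K S n :=
  LinearMap.mk₂ K (fun f g => ⟨cupCochain K S h f g, cup_mem_cocycles K S h f g⟩)
    (fun f f' g => by ext1; simp)
    (fun c f g => by ext1; simp)
    (fun f g g' => by ext1; simp)
    (fun c f g => by ext1; simp)

/-- The cup product `Hᵖ × H^q → Hⁿ`, `p + q = n`. -/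
def cup (S : SSet.{u}) {p q n : ℕ} (h : p + q = n) :
    Coh K S p →ₗ[K] Coh K S q →ₗ[K] Coh K S n :=
  Submodule.liftQ _
    (LinearMap.flip (Submodule.liftQ _
      (LinearMap.flip ((cupCocycle K S h).compr₂ (cohClass K S n)))
      (fun g hg => by
        refine LinearMap.mem_ker.2 (LinearMap.ext fun f => ?_)
        exact (cohClass_eq_zero K S n _).2 (cup_mem_coboundaries_right K S h f g hg))))
    (fun f hf => by
      refine LinearMap.mem_ker.2 (LinearMap.ext fun g => ?_)
      obtain ⟨g, rfl⟩ := cohClass_surjective K S q g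
      exact (cohClass_eq_zero K S n _).2 (cup_mem_coboundaries_left K S h f hf g))

theorem cup_class (S : SSet.{u}) {p q n : ℕ} (h : p + q = n) (f : cocycles K S p)
    (g : cocycles K S q) :
    cup K S h (cohClass K S p f) (cohClass K S q g) = cohClass K S n (cupCocycle K S h f g) :=
  rfl

/-- The unit class in `H⁰`. -/
def cohOne (S : SSet.{u}) : Coh K S 0 :=
  cohClass K S 0 ⟨oneCochain K S, coboundary_oneCochain S⟩

theorem cup_assoc (S : SSet.{u}) {p q r k l n : ℕ} (h₁ : p + q = k) (h₂ : k + r = n)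
    (h₃ : q + r = l) (h₄ : p + l = n) (x : Coh K S p) (y : Coh K S q) (z : Coh K S r) :
    cup K S h₂ (cup K S h₁ x y) z = cup K S h₄ x (cup K S h₃ y z) := by
  obtain ⟨x, rfl⟩ := cohClass_surjective K S p x
  obtain ⟨y, rfl⟩ := cohClass_surjective K S q y
  obtain ⟨z, rfl⟩ := cohClass_surjective K S r z
  simp only [cup_class]
  exact congrArg _ (Subtype.ext (cupCochain_assoc S h₁ h₂ h₃ h₄ _ _ _))

theorem one_cup (S : SSet.{u}) {p : ℕ} (h : 0 + p = p) (x : Coh K S p) :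
    cup K S h (cohOne K S) x = x := by
  obtain ⟨x, rfl⟩ := cohClass_surjective K S p x
  exact congrArg _ (Subtype.ext (one_cupCochain S h _))

theorem cup_one (S : SSet.{u}) {p : ℕ} (h : p + 0 = p) (x : Coh K S p) :
    cup K S h x (cohOne K S) = x := by
  obtain ⟨x, rfl⟩ := cohClass_surjective K S p x
  exact congrArg _ (Subtype.ext (cupCochain_one S h _))

theorem mk_cup (S : SSet.{u}) {p q n : ℕ} (h : p + q = n) (x : Coh K S p) (y : Coh K S q) :
    GradedMonoid.mk (A := Coh K S) (p + q) (cup K S rfl x y) = GradedMonoid.mk n (cup K S h x y) := by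
  subst h
  rfl

instance (S : SSet.{u}) : GradedMonoid.GOne (Coh K S) where
  one := cohOne K S

instance (S : SSet.{u}) : GradedMonoid.GMul (Coh K S) where
  mul x y := cup K S rfl x y

/-- The cup product makes the cohomology a graded ring. -/
instance (S : SSet.{u}) : DirectSum.GRing (Coh K S) where
  mul_zero x := map_zero (cup K S rfl x)
  zero_mul y := by
    change cup K S rfl 0 y = 0
    rw [map_zero, LinearMap.zero_apply]
  mul_add x y z := map_add (cup K S rfl x) y z
  add_mul x y z := by
    change cup K S rfl (x + y) z = cup K S rfl x z + cup K S rfl y z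
    rw [map_add, LinearMap.add_apply]
  one_mul := fun ⟨p, x⟩ => by
    change GradedMonoid.mk (0 + p) (cup K S rfl (cohOne K S) x) = GradedMonoid.mk p x
    rw [mk_cup K S (Nat.zero_add p), one_cup]
  mul_one := fun ⟨p, x⟩ => by
    change GradedMonoid.mk (p + 0) (cup K S rfl x (cohOne K S)) = GradedMonoid.mk p x
    rw [mk_cup K S (Nat.add_zero p), cup_one]
  mul_assoc := fun ⟨p, x⟩ ⟨q, y⟩ ⟨r, z⟩ => by
    change GradedMonoid.mk (p + q + r) (cup K S rfl (cup K S rfl x y) z) =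
      GradedMonoid.mk (p + (q + r)) (cup K S rfl x (cup K S rfl y z))
    rw [mk_cup K S (Nat.add_assoc p q r), cup_assoc K S rfl (Nat.add_assoc p q r) rfl rfl]
  natCast n := n • cohOne K S
  natCast_zero := zero_smul _ _
  natCast_succ n := succ_nsmul _ n
  intCast n := n • cohOne K S
  intCast_ofNat n := natCast_zsmul _ n
  intCast_negSucc_ofNat n := negSucc_zsmul _ n

theorem gmul_eq_cup (S : SSet.{u}) {p q : ℕ} (x : Coh K S p) (y : Coh K S q) :
    GradedMonoid.GMul.mul x y = cup K S rfl x y := rfl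

/-- The cohomology is a graded algebra over the coefficient field. -/
instance (S : SSet.{u}) : DirectSum.GAlgebra K (Coh K S) where
  toFun :=
    { toFun := fun c => c • cohOne K S
      map_zero' := zero_smul _ _
      map_add' := fun a b => add_smul a b _ }
  map_one := one_smul _ _
  map_mul r s := by
    change GradedMonoid.mk 0 ((r * s) • cohOne K S) =
      GradedMonoid.mk (0 + 0) (cup K S rfl (r • cohOne K S) (s • cohOne K S))
    rw [map_smul, map_smul, LinearMap.smul_apply, one_cup, smul_smul, mul_comm]
  commutes r := fun ⟨p, x⟩ => by
    change GradedMonoid.mk (0 + p) (cup K S rfl (r • cohOne K S) x) =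
      GradedMonoid.mk (p + 0) (cup K S rfl x (r • cohOne K S))
    rw [mk_cup K S (Nat.zero_add p), mk_cup K S (Nat.add_zero p), map_smul, map_smul,
      LinearMap.smul_apply, one_cup, cup_one]
  smul_def r := fun ⟨p, x⟩ => by
    change GradedMonoid.mk p (r • x) = GradedMonoid.mk (0 + p) (cup K S rfl (r • cohOne K S) x)
    rw [mk_cup K S (Nat.zero_add p), map_smul, LinearMap.smul_apply, one_cup]

/-- The graded cohomology ring `H^*(S; K) = ⨁ₚ Hᵖ(S; K)` with the cup product. -/
abbrev CohRing (S : SSet.{u}) : Type (max u v) := ⨁ p, Coh K S p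

variable {S T U : SSet.{u}}

theorem cochainMap_mem_cocycles (φ : S ⟶ T) (n : ℕ) (f : cocycles K T n) :
    cochainMap K φ n (f : Cochain K T n) ∈ cocycles K S n := by
  have hf : coboundary K T n (f : Cochain K T n) = 0 := f.2
  change coboundary K S n _ = 0
  rw [coboundary_cochainMap, hf, map_zero]

theorem cochainMap_mem_coboundaries (φ : S ⟶ T) (n : ℕ) (f : Cochain K T n)
    (hf : f ∈ coboundaries K T n) : cochainMap K φ n f ∈ coboundaries K S n := by
  cases n with
  | zero =>
    have hf0 : f = 0 := hf
    rw [hf0, map_zero]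
    exact Submodule.zero_mem _
  | succ n =>
    obtain ⟨e, rfl⟩ := hf
    exact ⟨cochainMap K φ n e, coboundary_cochainMap φ n e⟩

/-- Pullback of cocycles. -/
def cocycleMap (φ : S ⟶ T) (n : ℕ) : cocycles K T n →ₗ[K] cocycles K S n :=
  (cochainMap K φ n).restrict fun f hf => cochainMap_mem_cocycles K φ n ⟨f, hf⟩

/-- The map `Hⁿ(φ) : Hⁿ(T) → Hⁿ(S)` induced by `φ : S ⟶ T`. -/
def cohMap (φ : S ⟶ T) (n : ℕ) : Coh K T n →ₗ[K] Coh K S n :=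
  Submodule.mapQ _ _ (cocycleMap K φ n) fun f hf => cochainMap_mem_coboundaries K φ n f hf

theorem cohMap_class (φ : S ⟶ T) (n : ℕ) (f : cocycles K T n) :
    cohMap K φ n (cohClass K T n f) = cohClass K S n (cocycleMap K φ n f) := rfl

theorem cohMap_id (n : ℕ) (x : Coh K S n) : cohMap K (𝟙 S) n x = x := by
  obtain ⟨x, rfl⟩ := cohClass_surjective K S n x
  rfl

theorem cohMap_comp (φ : S ⟶ T) (ψ : T ⟶ U) (n : ℕ) (x : Coh K U n) :
    cohMap K (φ ≫ ψ) n x = cohMap K φ n (cohMap K ψ n x) := by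
  obtain ⟨x, rfl⟩ := cohClass_surjective K U n x
  rfl

theorem cohMap_one (φ : S ⟶ T) : cohMap K φ 0 (cohOne K T) = cohOne K S := rfl

theorem cohMap_cup (φ : S ⟶ T) {p q n : ℕ} (h : p + q = n) (x : Coh K T p) (y : Coh K T q) :
    cohMap K φ n (cup K T h x y) = cup K S h (cohMap K φ p x) (cohMap K φ q y) := by
  obtain ⟨x, rfl⟩ := cohClass_surjective K T p x
  obtain ⟨y, rfl⟩ := cohClass_surjective K T q y
  simp only [cup_class, cohMap_class]
  exact congrArg _ (Subtype.ext (cochainMap_cup φ h _ _))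

/-- The graded algebra homomorphism `H^*(φ) : H^*(T) → H^*(S)`. -/
def cohRingMap (φ : S ⟶ T) : CohRing K T →ₐ[K] CohRing K S :=
  DirectSum.toAlgebra K (Coh K T) (fun p => DirectSum.lof K ℕ (Coh K S) p ∘ₗ cohMap K φ p)
    rfl
    (fun {p q} x y => by
      change DirectSum.of (Coh K S) (p + q) (cohMap K φ (p + q) (cup K T rfl x y)) =
        DirectSum.of (Coh K S) p (cohMap K φ p x) * DirectSum.of (Coh K S) q (cohMap K φ q y)
      rw [DirectSum.of_mul_of, gmul_eq_cup, cohMap_cup])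

theorem cohRingMap_lof (φ : S ⟶ T) (p : ℕ) (x : Coh K T p) :
    cohRingMap K φ (DirectSum.lof K ℕ (Coh K T) p x) =
      DirectSum.lof K ℕ (Coh K S) p (cohMap K φ p x) :=
  DirectSum.toModule_lof K p x

end Cohomology

/-! ### Length of a graded ring and cup powers -/

/-- The length of a graded ring: the supremum in `ℕ∞` of the numbers `ℓ` for which some product of
`ℓ` homogeneous elements of positive degree is non-zero. It is the largest such `ℓ` if there is a
largest one, and `⊤` otherwise. -/
def gradedLength {R : Type w} [Ring R] {G : Type*} [SetLike G R] (𝒜 : ℕ → G) : ℕ∞ :=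
  ⨆ (ℓ : ℕ) (_ : ∃ η : Fin ℓ → R, (∀ i, ∃ p, 1 ≤ p ∧ η i ∈ 𝒜 p) ∧ (List.ofFn η).prod ≠ 0),
    (ℓ : ℕ∞)

section CupPower

variable (K : Type v) [Field K]

/-- The grading of the image ring `im (H^*(T) → H^*(S))` by its intersections with the
homogeneous components of `H^*(S)`. -/
def imageGrading {S T : SSet.{u}} (φ : S ⟶ T) (p : ℕ) :
    Submodule K (cohRingMap K φ).range :=
  (LinearMap.range (DirectSum.lof K ℕ (Coh K S) p)).comap
    (cohRingMap K φ).range.val.toLinearMap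

/-- The cup-length of a map: the length of the image ring `im (H^*(T) → H^*(S))`. -/
def mapCupLength {S T : SSet.{u}} (φ : S ⟶ T) : ℕ∞ := gradedLength (imageGrading K φ)

/-- The positive-degree part `H⁺(S) = ⨁_{p ≥ 1} Hᵖ(S)` of the cohomology ring. -/
def positivePart (S : SSet.{u}) : Submodule K (CohRing K S) :=
  ⨆ p : ℕ+, LinearMap.range (DirectSum.lof K ℕ (Coh K S) p)

/-- The `ℓ`-fold product `(H⁺(S))^ℓ`: the subalgebra (without unit) generated by the products of
`ℓ` elements of `H⁺(S)`. -/
def cupPower (S : SSet.{u}) (ℓ : ℕ) : NonUnitalSubalgebra K (CohRing K S) :=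
  NonUnitalAlgebra.adjoin K
    {x | ∃ η : Fin ℓ → CohRing K S, (∀ i, η i ∈ positivePart K S) ∧ (List.ofFn η).prod = x}

/-- The degree-`p` component of `(H⁺(S))^ℓ`, as a subspace of `Hᵖ(S)`. -/
def cupPowerDeg (S : SSet.{u}) (ℓ p : ℕ) : Submodule K (Coh K S p) :=
  (cupPower K S ℓ).toSubmodule.comap (DirectSum.lof K ℕ (Coh K S) p)

variable {S T : SSet.{u}}

theorem cohRingMap_positivePart (φ : S ⟶ T) {x : CohRing K T} (hx : x ∈ positivePart K T) :
    cohRingMap K φ x ∈ positivePart K S := by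
  have : positivePart K T ≤ (positivePart K S).comap (cohRingMap K φ).toLinearMap := by
    refine iSup_le fun p => ?_
    rintro _ ⟨y, rfl⟩
    refine Submodule.mem_iSup_of_mem p ⟨cohMap K φ p y, ?_⟩
    exact (cohRingMap_lof K φ p y).symm
  exact this hx

theorem cohRingMap_cupPower (φ : S ⟶ T) (ℓ : ℕ) {x : CohRing K T} (hx : x ∈ cupPower K T ℓ) :
    cohRingMap K φ x ∈ cupPower K S ℓ := by
  induction hx using NonUnitalAlgebra.adjoin_induction with
  | mem x hx =>
    obtain ⟨η, hη, rfl⟩ := hx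
    refine NonUnitalAlgebra.subset_adjoin K
      ⟨fun i => cohRingMap K φ (η i), fun i => cohRingMap_positivePart K φ (hη i), ?_⟩
    rw [map_list_prod, List.map_ofFn]
    rfl
  | add x y _ _ hx hy => rw [map_add]; exact add_mem hx hy
  | zero => rw [map_zero]; exact zero_mem _
  | mul x y _ _ hx hy => rw [map_mul]; exact mul_mem hx hy
  | smul c x _ hx => rw [map_smul]; exact SMulMemClass.smul_mem c hx

/-- The restriction `deg_p((H⁺(T))^ℓ) → deg_p((H⁺(S))^ℓ)` of `Hᵖ(φ)`. -/
def cupPowerMap (φ : S ⟶ T) (ℓ p : ℕ) : cupPowerDeg K T ℓ p →ₗ[K] cupPowerDeg K S ℓ p :=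
  (cohMap K φ p).restrict fun x hx => by
    have := cohRingMap_cupPower K φ ℓ (x := DirectSum.lof K ℕ (Coh K T) p x) hx
    rwa [cohRingMap_lof] at this

end CupPower

/-! ### Persistence modules and barcodes -/

/-- A (contravariant) persistence module, i.e. a functor from `(ℝ, ≤)` to the opposite of the
category of vector spaces over `K`. -/
structure PersistenceModule (K : Type v) [Field K] where
  /-- the vector space at each parameter -/
  V : ℝ → Type w
  [addCommGroup : ∀ t, AddCommGroup (V t)]
  [module : ∀ t, Module K (V t)]
  /-- the transition maps -/
  map : ∀ {s t : ℝ}, s ≤ t → V t →ₗ[K] V s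
  map_refl : ∀ (t : ℝ) (x : V t), map (le_refl t) x = x
  map_trans : ∀ {r s t : ℝ} (hrs : r ≤ s) (hst : s ≤ t) (x : V t),
    map (hrs.trans hst) x = map hrs (map hst x)

attribute [instance] PersistenceModule.addCommGroup PersistenceModule.module

namespace PersistenceModule

variable {K : Type v} [Field K]

/-- An isomorphism of persistence modules. -/
structure Iso (M : PersistenceModule.{v, w} K) (N : PersistenceModule.{v, u} K) where
  /-- the linear isomorphism at each parameter -/
  equiv : ∀ t, M.V t ≃ₗ[K] N.V t
  naturality : ∀ {s t : ℝ} (h : s ≤ t) (x : M.V t),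
    equiv s (M.map h x) = N.map h (equiv t x)

/-- The direct sum of persistence modules. -/
def directSum {ι : Type u} (M : ι → PersistenceModule.{v, w} K) :
    PersistenceModule.{v, max u w} K where
  V t := ⨁ l, (M l).V t
  map h := DirectSum.lmap fun l => (M l).map h
  map_refl t x := by
    classical
    ext l
    simp [map_refl]
  map_trans hrs hst x := by
    classical
    ext l
    simp [map_trans _ hrs hst]

variable (K) in
/-- The vector space of the interval module of `J` at `t`: it is `K` for `t ∈ J` and `0`
otherwise. -/
def intervalSpace (J : Set ℝ) (t : ℝ) : Submodule K K where
  carrier := {x | t ∉ J → x = 0}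
  add_mem' hx hy ht := by rw [hx ht, hy ht, add_zero]
  zero_mem' _ := rfl
  smul_mem' c x hx ht := by rw [hx ht, smul_zero]

open Classical in
variable (K) in
/-- The interval module of an interval `J`: its transition map from `t` to `s ≤ t` is the identity
of `K` if `s, t ∈ J`, and zero otherwise. -/
def intervalModule (J : Set ℝ) (hJ : J.OrdConnected) : PersistenceModule.{v, v} K where
  V t := intervalSpace K J t
  map {s t} _ :=
    { toFun := fun x => ⟨if s ∈ J then (x : K) else 0, fun hs => if_neg hs⟩
      map_add' := fun x y => by
        ext1
        by_cases hs : s ∈ J <;> simp [hs]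
      map_smul' := fun c x => by
        ext1
        by_cases hs : s ∈ J <;> simp [hs] }
  map_refl t x := by
    ext1
    by_cases ht : t ∈ J
    · exact if_pos ht
    · exact (if_neg ht).trans (x.2 ht).symm
  map_trans {r s t} hrs hst x := by
    ext1
    change (if r ∈ J then (x : K) else 0) = if r ∈ J then (if s ∈ J then (x : K) else 0) else 0
    by_cases hr : r ∈ J
    · by_cases hs : s ∈ J
      · simp [hr, hs]
      · have ht : t ∉ J := fun ht => hs (hJ.out hr ht ⟨hrs, hst⟩)
        simp [hr, hs, x.2 ht]
    · simp [hr]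

/-- A barcode of `M`: a family of intervals (non-empty order-connected sets of reals; the endpoints
may be open, closed or infinite) together with an isomorphism from `M` to the direct sum of their
interval modules. -/
structure Barcode (M : PersistenceModule.{v, max v w} K) where
  /-- the index set of the bars -/
  ι : Type (max v w)
  /-- the bars -/
  bar : ι → Set ℝ
  nonempty : ∀ l, (bar l).Nonempty
  ordConnected : ∀ l, (bar l).OrdConnected
  /-- the interval decomposition -/
  iso : Iso M (directSum fun l => intervalModule K (bar l) (ordConnected l))

end PersistenceModule

/-! ### Persistent spaces -/

section PersistentSpace

variable (K : Type v) [Field K] (X : ℝ ⥤ TopCat.{u})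

/-- The singular simplicial set of the space `X_t`. -/
abbrev sing (t : ℝ) : SSet.{u} := TopCat.toSSet.obj (X.obj t)

/-- The map of singular simplicial sets induced by the transition map `X_s → X_t`. -/
abbrev singMap {s t : ℝ} (h : s ≤ t) : sing X s ⟶ sing X t :=
  TopCat.toSSet.map (X.map (homOfLE h))

theorem cohMap_singMap_refl (t : ℝ) (p : ℕ) (x : Coh K (sing X t) p) :
    cohMap K (singMap X (le_refl t)) p x = x := by
  have : singMap X (le_refl t) = 𝟙 (sing X t) := by
    have h : homOfLE (le_refl t) = 𝟙 t := rfl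
    rw [singMap, h, X.map_id, TopCat.toSSet.map_id]
  rw [this, cohMap_id]

theorem cohMap_singMap_trans {r s t : ℝ} (hrs : r ≤ s) (hst : s ≤ t) (p : ℕ)
    (x : Coh K (sing X t) p) :
    cohMap K (singMap X (hrs.trans hst)) p x =
      cohMap K (singMap X hrs) p (cohMap K (singMap X hst) p x) := by
  have : singMap X (hrs.trans hst) = singMap X hrs ≫ singMap X hst := by
    rw [singMap, ← homOfLE_comp hrs hst, X.map_comp, TopCat.toSSet.map_comp]
  rw [this, cohMap_comp]

/-- The persistent cup-length invariant: the interval `[a, b]` is sent to the length of the image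
ring of `H^*(X_b) → H^*(X_a)`. -/
def persistentCupLength {a b : ℝ} (hab : a ≤ b) : ℕ∞ := mapCupLength K (singMap X hab)

/-- The `p`-th persistent (singular) cohomology of `X`. -/
def persistentCohomology (p : ℕ) : PersistenceModule.{v, max u v} K where
  V t := Coh K (sing X t) p
  map h := cohMap K (singMap X h) p
  map_refl t x := cohMap_singMap_refl K X t p x
  map_trans hrs hst x := cohMap_singMap_trans K X hrs hst p x

/-- The degree-`p` component of the persistent `ℓ`-cup module `t ↦ (H⁺(X_t))^ℓ`. -/
def persistentCupModule (ℓ p : ℕ+) : PersistenceModule.{v, max u v} K where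
  V t := cupPowerDeg K (sing X t) ℓ p
  map h := cupPowerMap K (singMap X h) ℓ p
  map_refl t x := Subtype.ext (cohMap_singMap_refl K X t p x)
  map_trans hrs hst x := Subtype.ext (cohMap_singMap_trans K X hrs hst p x)

/-- A persistence module is q-tame if its transition maps between distinct parameters have finite
rank. -/
def PersistenceModule.IsQTame {K : Type v} [Field K] (M : PersistenceModule.{v, w} K) : Prop :=
  ∀ ⦃s t : ℝ⦄ (h : s < t), FiniteDimensional K (LinearMap.range (M.map h.le))

/-- `t` is a critical value if there is no neighbourhood of `t` throughout which the transition
maps induce isomorphisms of the cohomology rings. -/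
def IsCriticalValue (t : ℝ) : Prop :=
  ¬ ∃ ε > 0, ∀ ⦃s s' : ℝ⦄ (h : s ≤ s'), t - ε < s → s' < t + ε →
    Function.Bijective (cohRingMap K (singMap X h))

variable {K X}

/-- The bars of the persistent `ℓ`-cup module: the bars of its components of all degrees `p ≥ 1`. -/
def cupBars (B : ∀ ℓ p : ℕ+, (persistentCupModule K X ℓ p).Barcode) (ℓ : ℕ+) : Set (Set ℝ) :=
  {J | ∃ (p : ℕ+) (l : (B ℓ p).ι), (B ℓ p).bar l = J}

/-- The largest `ℓ ≥ 1` such that `J` is a bar of the persistent `ℓ`-cup module: `0` if there is no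
such `ℓ`, and `⊤` if there are arbitrarily large ones. -/
def cupBarLength (B : ∀ ℓ p : ℕ+, (persistentCupModule K X ℓ p).Barcode) (J : Set ℝ) : ℕ∞ :=
  ⨆ (ℓ : ℕ+) (_ : J ∈ cupBars B ℓ), ((ℓ : ℕ) : ℕ∞)

end PersistentSpace

end CupPersistence

end

open CupPersistence

noncomputable section

open scoped DirectSum Pointwise

namespace CupPersistence

open Submodule

/-! ### Bases adapted to chains of subspaces -/

section AdaptedBases

variable {K : Type v} [Field K] {V : Type w} [AddCommGroup V] [Module K V]

/-! The cup-length formula compares two criteria for the non-vanishing of the same maps. In an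
interval decomposition, a transition map from `b` to `a` is non-zero exactly when some bar contains
`[a, b]` (`map_ne_zero_iff`). The map between the `ℓ`-cup modules is non-zero in some positive
degree exactly when the image ring has a non-zero product of `ℓ` homogeneous elements of positive
degree (`exists_prod_ne_zero_iff`), since such products lift to homogeneous products and,
conversely, they account for the images of all generators of the cup power. Taking suprema over `ℓ`
gives the formula.

Independence of the decomposition only concerns which sets occur as bars, not their multiplicities,
so no full Krull–Schmidt theorem is needed. The identity of a summand `K_J` factors through the
other decomposition, so some composite `K_J → K_J' → K_J` is non-zero, and this forces `J = J'`
(`eq_of_natural_comp_ne_zero`).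

For the existence of barcodes, the cup modules inherit q-tameness and are locally constant off the
critical values, which form a closed discrete, hence locally finite, set. Up to isomorphism such a
module is determined by its values along a `ℤ`-indexed sequence of parameters (`exists_strata`,
`exists_equiv_of_monotone`). These values may be infinite-dimensional, so finite-dimensional
decomposition theorems do not apply. Instead, images from larger parameters form a well-ordered
chain by q-tameness, and kernels to smaller ones do because the indices are bounded above. A basis
at index `0` adapted to both chains (`exists_isAdaptedBasis_both`) is pushed to the left respecting
kernels and lifted to the right respecting images (`exists_isMatched_left`,
`exists_isMatched_right`). The resulting bases match up to zeros, and each bar is the lifetime of a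
basis vector (`MatchedFamily.barcode`). -/

/-- A family of subspaces that is well-ordered by inclusion. -/
def WellOrderedChain (𝓕 : Set (Submodule K V)) : Prop :=
  ∀ 𝓖 ⊆ 𝓕, 𝓖.Nonempty → ∃ F, IsLeast 𝓖 F

/-- A linearly independent set with span `E` that contains a basis of `E ⊓ F` for each member `F`
of `𝓕`. -/
structure IsAdaptedBasis (𝓕 : Set (Submodule K V)) (E : Submodule K V) (S : Set V) : Prop where
  linearIndepOn : LinearIndepOn K id S
  span_eq : span K S = E
  inf_le : ∀ F ∈ 𝓕, F ⊓ E ≤ span K (S ∩ F)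

theorem exists_mem_span_of_mem_span_sUnion {c : Set (Set V)} (hc : IsChain (· ⊆ ·) c)
    (hne : c.Nonempty) {x : V} (hx : x ∈ span K (⋃₀ c)) : ∃ s ∈ c, x ∈ span K s := by
  have : Nonempty c := hne.to_subtype
  have hd : Directed (· ≤ ·) fun s : c => span K (s : Set V) := fun a b =>
    let ⟨z, h₁, h₂⟩ := hc.directedOn.directed_val a b
    ⟨z, span_mono h₁, span_mono h₂⟩
  rw [Set.sUnion_eq_iUnion, span_iUnion, mem_iSup_of_directed _ hd] at hx
  obtain ⟨s, hs⟩ := hx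
  exact ⟨s, s.2, hs⟩

/-- Zorn's lemma replaces a transfinite recursion along the chain: a maximal independent set that is
adapted within its own span must span `E`, because otherwise a vector from the first member not yet
exhausted can be added. -/
theorem exists_isAdaptedBasis_superset {𝓕 : Set (Submodule K V)} (h𝓕 : WellOrderedChain 𝓕)
    {E₀ E : Submodule K V} (hE : E₀ ≤ E) {S₀ : Set V} (h₀ : IsAdaptedBasis 𝓕 E₀ S₀) :
    ∃ S, S₀ ⊆ S ∧ IsAdaptedBasis 𝓕 E S := by
  let Z : Set (Set V) := {S | LinearIndepOn K id S ∧ S ⊆ E ∧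
    ∀ F ∈ 𝓕, F ⊓ span K S ≤ span K (S ∩ F)}
  have hS₀ : S₀ ∈ Z := by
    refine ⟨h₀.linearIndepOn, fun x hx => hE ?_, fun F hF => ?_⟩
    · rw [← h₀.span_eq]
      exact subset_span hx
    · rw [h₀.span_eq]
      exact h₀.inf_le F hF
  obtain ⟨S, hS₀S, hmax⟩ := zorn_subset_nonempty Z (fun c hcZ hc hne => by
    refine ⟨⋃₀ c, ⟨?_, Set.sUnion_subset fun s hs => (hcZ hs).2.1, fun F hF x hx => ?_⟩,
      fun s hs => Set.subset_sUnion_of_mem hs⟩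
    · exact linearIndepOn_sUnion_of_directed hc.directedOn fun s hs => (hcZ hs).1
    · obtain ⟨hxF, hx⟩ := hx
      obtain ⟨s, hs, hxs⟩ := exists_mem_span_of_mem_span_sUnion hc hne hx
      exact span_mono (Set.inter_subset_inter_left _ (Set.subset_sUnion_of_mem hs))
        ((hcZ hs).2.2 F hF ⟨hxF, hxs⟩)) S₀ hS₀
  obtain ⟨hli, hSE, had⟩ := hmax.prop
  have hle : span K S ≤ E := span_le.2 hSE
  have hspan : span K S = E := by
    by_contra hne
    -- The vector comes from the least member whose trace on `E` is not yet covered. Every member is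
    -- then either covered or contains `v`, so adding `v` keeps the set adapted.
    obtain ⟨v, hvE, hvS, hv⟩ : ∃ v ∈ E, v ∉ span K S ∧
        ∀ F ∈ 𝓕, F ⊓ E ≤ span K S ∨ v ∈ F := by
      by_cases h : ({F ∈ 𝓕 | ¬ F ⊓ E ≤ span K S} : Set _).Nonempty
      · obtain ⟨F, hF, hleast⟩ := h𝓕 _ (Set.sep_subset _ _) h
        obtain ⟨v, hvF, hvS⟩ := SetLike.not_le_iff_exists.1 hF.2
        refine ⟨v, hvF.2, hvS, fun F' hF' => ?_⟩
        by_cases h' : F' ⊓ E ≤ span K S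
        · exact Or.inl h'
        · exact Or.inr (hleast ⟨hF', h'⟩ hvF.1)
      · obtain ⟨v, hvE, hvS⟩ := SetLike.not_le_iff_exists.1 fun h => hne (le_antisymm hle h)
        refine ⟨v, hvE, hvS, fun F hF => Or.inl ?_⟩
        by_contra h'
        exact h ⟨F, hF, h'⟩
    have hins : insert v S ∈ Z := by
      refine ⟨?_, Set.insert_subset hvE hSE, fun F hF x hx => ?_⟩
      · have hv' : v ∉ span K (id '' S) := by rwa [Set.image_id]
        exact hli.insert hv'
      · obtain ⟨hxF, hx⟩ := hx
        obtain ⟨c, y, hy, rfl⟩ := mem_span_insert.1 hx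
        have hxE : c • v + y ∈ E := E.add_mem (E.smul_mem c hvE) (hle hy)
        have hmono : span K (S ∩ F) ≤ span K (insert v S ∩ F) :=
          span_mono (Set.inter_subset_inter_left _ (Set.subset_insert v S))
        by_cases hc : c • v + y ∈ span K S
        · exact hmono (had F hF ⟨hxF, hc⟩)
        · rcases hv F hF with h | h
          · exact absurd (h ⟨hxF, hxE⟩) hc
          · refine add_mem (smul_mem _ _ (subset_span ⟨Set.mem_insert v S, h⟩))
              (hmono (had F hF ⟨?_, hy⟩))
            have := F.sub_mem hxF (F.smul_mem c h)
            rwa [add_sub_cancel_left] at this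
    exact hvS (subset_span (hmax.le_of_ge hins (Set.subset_insert v S) (Set.mem_insert v S)))
  exact ⟨S, hS₀S, hli, hspan, fun F hF => hspan ▸ had F hF⟩

theorem isAdaptedBasis_empty (𝓕 : Set (Submodule K V)) : IsAdaptedBasis 𝓕 ⊥ ∅ :=
  ⟨linearIndepOn_empty K id, span_empty, fun F _ => by simp⟩

theorem exists_isAdaptedBasis {𝓕 : Set (Submodule K V)} (h𝓕 : WellOrderedChain 𝓕)
    (E : Submodule K V) : ∃ S, IsAdaptedBasis 𝓕 E S :=
  let ⟨S, _, hS⟩ := exists_isAdaptedBasis_superset h𝓕 bot_le (isAdaptedBasis_empty 𝓕)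
  ⟨S, hS⟩

/-- Two well-ordered chains of subspaces have a common adapted basis. -/
theorem exists_isAdaptedBasis_both {𝓕 𝓖 : Set (Submodule K V)} (h𝓕 : WellOrderedChain 𝓕)
    (h𝓖 : WellOrderedChain 𝓖) : ∃ S, IsAdaptedBasis 𝓕 ⊤ S ∧ IsAdaptedBasis 𝓖 ⊤ S := by
  -- The two chains play different roles: `𝓖` is respected at each stage, while the last clause says
  -- that the members of `𝓕` are filled in order, each one being complete before the span leaves it.
  let Z : Set (Set V) := {S | LinearIndepOn K id S ∧
    (∀ G ∈ 𝓖, G ⊓ span K S ≤ span K (S ∩ G)) ∧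
    ∀ F ∈ 𝓕, F ≤ span K (S ∩ F) ∨ span K S ≤ F}
  obtain ⟨S, -, hmax⟩ := zorn_subset_nonempty Z (fun c hcZ hc hne => by
    refine ⟨⋃₀ c, ⟨?_, fun G hG x hx => ?_, fun F hF => ?_⟩,
      fun s hs => Set.subset_sUnion_of_mem hs⟩
    · exact linearIndepOn_sUnion_of_directed hc.directedOn fun s hs => (hcZ hs).1
    · obtain ⟨hxF, hx⟩ := hx
      obtain ⟨s, hs, hxs⟩ := exists_mem_span_of_mem_span_sUnion hc hne hx
      exact span_mono (Set.inter_subset_inter_left _ (Set.subset_sUnion_of_mem hs))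
        ((hcZ hs).2.1 G hG ⟨hxF, hxs⟩)
    · by_cases h : ∃ s ∈ c, F ≤ span K (s ∩ F)
      · obtain ⟨s, hs, hF⟩ := h
        exact Or.inl (hF.trans
          (span_mono (Set.inter_subset_inter_left _ (Set.subset_sUnion_of_mem hs))))
      · refine Or.inr (span_le.2 (Set.sUnion_subset fun s hs => span_le.1 ?_))
        exact ((hcZ hs).2.2 F hF).resolve_left fun h' => h ⟨s, hs, h'⟩) ∅
    ⟨linearIndepOn_empty K id, fun G _ => by simp, fun F _ => Or.inr (by simp)⟩
  obtain ⟨hli, hG, hF⟩ := hmax.prop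
  -- If no member of `𝓕` obstructs the passage from `span K S` to `E`, a `𝓖`-adapted extension of
  -- `S` to a basis of `E` stays in `Z`, so maximality leaves no room between the two.
  have key : ∀ E : Submodule K V, span K S ≤ E →
      (∀ F ∈ 𝓕, F ≤ span K S ∨ E ≤ F) → span K S = E := fun E hE hEF => by
    obtain ⟨S', hSS', hS'⟩ := exists_isAdaptedBasis_superset h𝓖 hE ⟨hli, rfl, hG⟩
    have hS'Z : S' ∈ Z := by
      refine ⟨hS'.linearIndepOn, fun G hG' => hS'.span_eq ▸ hS'.inf_le G hG', fun F hF' => ?_⟩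
      rw [hS'.span_eq]
      rcases hEF F hF' with h | h
      · rcases hF F hF' with h' | h'
        · exact Or.inl (h'.trans (span_mono (Set.inter_subset_inter_left _ hSS')))
        · refine Or.inl (h.trans (span_mono fun x hx => ⟨hSS' hx, h' (subset_span hx)⟩))
      · exact Or.inr h
    exact le_antisymm hE (hS'.span_eq ▸ span_mono (hmax.le_of_ge hS'Z hSS'))
  have hle : ∀ F ∈ 𝓕, F ≤ span K S := by
    by_contra! h
    obtain ⟨F₀, hF₀⟩ := h
    obtain ⟨F, hFm, hleast⟩ := h𝓕 {F ∈ 𝓕 | ¬ F ≤ span K S} (Set.sep_subset _ _) ⟨F₀, hF₀⟩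
    have hSF : span K S ≤ F := (hF F hFm.1).resolve_left fun h' =>
      hFm.2 (h'.trans (span_mono Set.inter_subset_left))
    refine hFm.2 (key F hSF fun F' hF' => ?_).ge
    by_cases h' : F' ≤ span K S
    · exact Or.inl h'
    · exact Or.inr (hleast ⟨hF', h'⟩)
  have htop : span K S = ⊤ := key ⊤ le_top fun F hF' => Or.inl (hle F hF')
  refine ⟨S, ⟨hli, htop, fun F hF' => ?_⟩, ⟨hli, htop, fun G hG' => htop ▸ hG G hG'⟩⟩
  rw [inf_top_eq]
  rcases hF F hF' with h | h
  · exact h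
  · exact (hle F hF').trans (span_mono fun x hx => ⟨hx, h (subset_span hx)⟩)

end AdaptedBases

/-! ### Matched bases of a persistence module -/

section MatchedBases

variable {K : Type v} [Field K]

/-- A linear map takes a set of vectors to another one, up to zeros, and is injective on the vectors
it does not kill. -/
structure IsMatched {V W : Type*} [AddCommGroup V] [Module K V] [AddCommGroup W] [Module K W]
    (f : V →ₗ[K] W) (B : Set V) (C : Set W) : Prop where
  map_mem : ∀ b ∈ B, f b ≠ 0 → f b ∈ C
  injOn : ∀ b ∈ B, ∀ b' ∈ B, f b = f b' → f b ≠ 0 → b = b'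

theorem IsMatched.comp {V W U : Type*} [AddCommGroup V] [Module K V] [AddCommGroup W] [Module K W]
    [AddCommGroup U] [Module K U] {f : V →ₗ[K] W} {g : W →ₗ[K] U} {B : Set V} {C : Set W}
    {D : Set U} (hg : IsMatched g C D) (hf : IsMatched f B C) : IsMatched (g ∘ₗ f) B D where
  map_mem b hb hne := by
    have hfb : f b ≠ 0 := fun h => hne (by simp [h])
    exact hg.map_mem _ (hf.map_mem b hb hfb) hne
  injOn b hb b' hb' h hne := by
    have hfb : f b ≠ 0 := fun h => hne (by simp [h])
    have hfb' : f b' ≠ 0 := fun h' => hne (h.trans (by simp [h']))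
    exact hf.injOn b hb b' hb'
      (hg.injOn _ (hf.map_mem b hb hfb) _ (hf.map_mem b' hb' hfb') h hne) hfb

variable (M : PersistenceModule.{v, w} K) (D : Set ℝ)

/-- The kernels of the transition maps from `t` to the parameters in `D`. -/
def kernelChain (t : ℝ) : Set (Submodule K (M.V t)) :=
  {F | ∃ (s : ℝ) (h : s ≤ t), s ∈ D ∧ LinearMap.ker (M.map h) = F}

/-- The images of the transition maps from the parameters in `D` to `t`. -/
def imageChain (t : ℝ) : Set (Submodule K (M.V t)) :=
  {F | ∃ (s : ℝ) (h : t ≤ s), s ∈ D ∧ LinearMap.range (M.map h) = F}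

variable {M D}

theorem ker_map_anti {r s t : ℝ} (hrs : r ≤ s) (hst : s ≤ t) :
    LinearMap.ker (M.map hst) ≤ LinearMap.ker (M.map (hrs.trans hst)) := fun x hx => by
  rw [LinearMap.mem_ker] at hx ⊢
  rw [M.map_trans hrs hst, hx, map_zero]

theorem range_map_anti {r s t : ℝ} (hrs : r ≤ s) (hst : s ≤ t) :
    LinearMap.range (M.map (hrs.trans hst)) ≤ LinearMap.range (M.map hrs) := by
  rintro _ ⟨x, rfl⟩
  exact ⟨M.map hst x, (M.map_trans hrs hst x).symm⟩

/-- A basis adapted to kernels extends to smaller parameters. -/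
theorem exists_isMatched_left {s t : ℝ} (h : s ≤ t) (hs : s ∈ D)
    (hwo : WellOrderedChain (kernelChain M D s)) {B : Set (M.V t)}
    (hB : IsAdaptedBasis (kernelChain M D t) ⊤ B) :
    ∃ C, IsAdaptedBasis (kernelChain M D s) ⊤ C ∧ IsMatched (M.map h) B C := by
  set f := M.map h with hf
  have hker : LinearMap.ker f ≤ span K (B ∩ LinearMap.ker f) := by
    have := hB.inf_le _ ⟨s, h, hs, rfl⟩
    rwa [inf_top_eq] at this
  -- Adaptedness lets `B ∩ ker f` span the kernel, so the remaining basis vectors span a complement,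
  -- on which `f` is injective.
  have hdisj : Disjoint (span K (B \ LinearMap.ker f)) (LinearMap.ker f) := by
    have h' : LinearIndepOn K id (B \ LinearMap.ker f ∪ B ∩ LinearMap.ker f) := by
      rw [Set.sdiff_union_inter]
      exact hB.linearIndepOn
    exact ((linearIndepOn_id_union_iff Set.disjoint_sdiff_inter).1 h').2.2.mono_right hker
  have hbasis : IsAdaptedBasis (kernelChain M D s) (LinearMap.range f)
      (f '' (B \ LinearMap.ker f)) := by
    have himage : ∀ T : Submodule K (M.V t), T ≤ span K (B ∩ T) →
        T.map f ≤ span K (f '' (B \ LinearMap.ker f) ∩ T.map f) := fun T hT => by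
      refine (map_mono hT).trans ?_
      rw [map_span, span_le]
      rintro _ ⟨b, hb, rfl⟩
      by_cases h0 : f b = 0
      · rw [h0]
        exact zero_mem _
      · exact subset_span ⟨⟨b, ⟨hb.1, h0⟩, rfl⟩, ⟨b, hb.2, rfl⟩⟩
    refine ⟨(hB.linearIndepOn.mono Set.sdiff_subset).image hdisj, le_antisymm ?_ ?_, ?_⟩
    · rw [span_le]
      rintro _ ⟨b, _, rfl⟩
      exact ⟨b, rfl⟩
    · rw [LinearMap.range_eq_map]
      refine (himage ⊤ ?_).trans (span_mono Set.inter_subset_left)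
      rw [top_coe, Set.inter_univ, hB.span_eq]
    -- The trace on `range f` of the kernel of the map to `r` is the image under `f` of the
    -- corresponding kernel at `t`, to which `B` is already adapted.
    · rintro _ ⟨r, hr, hrD, rfl⟩ _ ⟨hx, x, rfl⟩
      have hx' : x ∈ LinearMap.ker (M.map (hr.trans h)) := by
        rw [LinearMap.mem_ker, M.map_trans hr h]
        exact hx
      have hT : LinearMap.ker (M.map (hr.trans h)) ≤
          span K (B ∩ LinearMap.ker (M.map (hr.trans h))) := by
        have := hB.inf_le _ ⟨r, hr.trans h, hrD, rfl⟩
        rwa [inf_top_eq] at this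
      refine span_mono (Set.inter_subset_inter_right _ ?_) (himage _ hT ⟨x, hx', rfl⟩)
      rintro _ ⟨y, hy, rfl⟩
      have hy' : M.map (hr.trans h) y = 0 := hy
      rwa [M.map_trans hr h] at hy'
  obtain ⟨C, hsub, hC⟩ := exists_isAdaptedBasis_superset hwo le_top hbasis
  refine ⟨C, hC, fun b hb hne => hsub ⟨b, ⟨hb, hne⟩, rfl⟩, fun b hb b' hb' heq hne => ?_⟩
  exact LinearMap.injOn_of_disjoint_ker subset_span hdisj ⟨hb, hne⟩
    ⟨hb', fun h0 => hne (heq.trans h0)⟩ heq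

/-- A basis adapted to images lifts to larger parameters. -/
theorem exists_isMatched_right {t s : ℝ} (h : t ≤ s) (hs : s ∈ D)
    (hwo : WellOrderedChain (imageChain M D s)) {B : Set (M.V t)}
    (hB : IsAdaptedBasis (imageChain M D t) ⊤ B) :
    ∃ C, IsAdaptedBasis (imageChain M D s) ⊤ C ∧ IsMatched (M.map h) C B := by
  set f := M.map h with hf
  have hlift : ∀ b ∈ B ∩ LinearMap.range f, ∃ y, f y = b ∧ ∀ (r : ℝ) (hr : s ≤ r), r ∈ D →
      b ∈ LinearMap.range (M.map (h.trans hr)) → y ∈ LinearMap.range (M.map hr) := by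
    intro b hb
    -- The lift is taken in the smallest image at `s` that can contain a lift of `b`, so one choice
    -- works for all `r` at once. The parameter `s` itself shows that there is a candidate.
    obtain ⟨F, ⟨r, hr, -, ⟨x, hx⟩, rfl⟩, hleast⟩ := hwo
      {F | ∃ (r : ℝ) (hr : s ≤ r), r ∈ D ∧ b ∈ LinearMap.range (M.map (h.trans hr)) ∧
        LinearMap.range (M.map hr) = F}
      (fun F ⟨r, hr, hrD, _, hF⟩ => ⟨r, hr, hrD, hF⟩) ⟨_, s, le_rfl, hs, hb.2, rfl⟩
    refine ⟨M.map hr x, ?_, fun r' hr' hrD' hb' => hleast ⟨r', hr', hrD', hb', rfl⟩ ⟨x, rfl⟩⟩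
    rw [hf, ← M.map_trans h hr, hx]
  choose! g hg hgr using hlift
  have hfg : LinearIndepOn K (f ∘ g) (B ∩ LinearMap.range f) :=
    (hB.linearIndepOn.mono Set.inter_subset_left).congr fun b hb => (hg b hb).symm
  have hdisj : Disjoint (span K (g '' (B ∩ LinearMap.range f))) (LinearMap.ker f) := by
    have := range_ker_disjoint (f := f) (v := fun b : ↥(B ∩ LinearMap.range f) => g b) hfg
    rwa [Set.image_eq_range]
  obtain ⟨S, hS⟩ := exists_isAdaptedBasis hwo (LinearMap.ker f)
  have hadapted : ∀ F ∈ imageChain M D s,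
      F ≤ span K ((g '' (B ∩ LinearMap.range f) ∪ S) ∩ F) := by
    rintro _ ⟨r, hr, hrD, rfl⟩ x hx
    have hfx : f x ∈ span K (B ∩ LinearMap.range (M.map (h.trans hr))) := by
      refine hB.inf_le _ ⟨r, h.trans hr, hrD, rfl⟩ ⟨?_, trivial⟩
      obtain ⟨y, rfl⟩ := hx
      exact ⟨y, M.map_trans h hr y⟩
    obtain ⟨z, hz, hzx⟩ : ∃ z ∈ span K (g '' (B ∩ LinearMap.range f) ∩ LinearMap.range (M.map hr)),
        f z = f x := by
      have hle : span K (B ∩ LinearMap.range (M.map (h.trans hr))) ≤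
          (span K (g '' (B ∩ LinearMap.range f) ∩ LinearMap.range (M.map hr))).map f := by
        rw [span_le]
        intro b hb
        have hb' : b ∈ B ∩ LinearMap.range f := ⟨hb.1, range_map_anti h hr hb.2⟩
        exact ⟨g b, subset_span ⟨⟨b, hb', rfl⟩, hgr b hb' r hr hrD hb.2⟩, hg b hb'⟩
      exact hle hfx
    have hzr : z ∈ LinearMap.range (M.map hr) := span_le.2 Set.inter_subset_right hz
    -- Subtracting the chosen lift of `f x` leaves an element of the kernel that still lies in the
    -- image from `r`; the adapted basis `S` of the kernel deals with it.
    have hd : x - z ∈ span K (S ∩ LinearMap.range (M.map hr)) := by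
      refine hS.inf_le _ ⟨r, hr, hrD, rfl⟩ ⟨sub_mem hx hzr, ?_⟩
      change f (x - z) = 0
      rw [map_sub, hzx, sub_self]
    rw [← sub_add_cancel x z]
    exact add_mem (span_mono (Set.inter_subset_inter_left _ Set.subset_union_right) hd)
      (span_mono (Set.inter_subset_inter_left _ Set.subset_union_left) hz)
  have hker : ∀ b ∈ S, f b = 0 := fun b hb => by
    have : b ∈ LinearMap.ker f := hS.span_eq ▸ subset_span hb
    exact this
  refine ⟨g '' (B ∩ LinearMap.range f) ∪ S, ⟨?_, ?_, fun F hF => ?_⟩, ?_, ?_⟩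
  · exact (LinearIndepOn.of_comp f hfg).id_image.id_union hS.linearIndepOn (hS.span_eq ▸ hdisj)
  · refine top_le_iff.1 ?_
    have := hadapted _ ⟨s, le_rfl, hs, rfl⟩
    have htop : LinearMap.range (M.map (le_refl s)) = ⊤ :=
      LinearMap.range_eq_top.2 fun x => ⟨x, M.map_refl s x⟩
    rw [htop] at this
    exact this.trans (span_mono Set.inter_subset_left)
  · rw [inf_top_eq]
    exact hadapted F hF
  · rintro _ (⟨b, hb, rfl⟩ | hb) hne
    · rw [hg b hb]
      exact hb.1
    · exact absurd (hker _ hb) hne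
  · rintro _ (⟨b, hb, rfl⟩ | hb) _ (⟨b', hb', rfl⟩ | hb') heq hne
    · rw [hg b hb, hg b' hb'] at heq
      rw [heq]
    · exact absurd (heq.trans (hker _ hb')) hne
    · exact absurd (hker _ hb) hne
    · exact absurd (hker _ hb) hne

/-- Images from parameters beyond `t` have finite dimension, so among nested ones a member of least
dimension is the smallest. The only possibly infinite-dimensional image comes from `t` itself and is
the whole space. -/
theorem wellOrderedChain_imageChain (hM : M.IsQTame) (D : Set ℝ) (t : ℝ) :
    WellOrderedChain (imageChain M D t) := by
  intro 𝓖 h𝓖 hne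
  have hchain : ∀ F ∈ 𝓖, ∀ G ∈ 𝓖, F ≤ G ∨ G ≤ F := by
    intro F hF G hG
    obtain ⟨r, hr, -, rfl⟩ := h𝓖 hF
    obtain ⟨s, hs, -, rfl⟩ := h𝓖 hG
    rcases le_total r s with h | h
    · exact Or.inr (range_map_anti hr h)
    · exact Or.inl (range_map_anti hs h)
  by_cases hfd : ∃ F ∈ 𝓖, FiniteDimensional K F
  · let N : Set ℕ := {n | ∃ F ∈ 𝓖, FiniteDimensional K F ∧ Module.finrank K F = n}
    have hN : N.Nonempty := let ⟨F, hF, hd⟩ := hfd; ⟨_, F, hF, hd, rfl⟩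
    obtain ⟨F, hF, hd, hr⟩ := Nat.sInf_mem hN
    refine ⟨F, hF, fun G hG => (hchain F hF G hG).elim id fun hle => ?_⟩
    have hGd : FiniteDimensional K G := finiteDimensional_of_le hle
    have : Module.finrank K F ≤ Module.finrank K G := hr ▸ Nat.sInf_le ⟨G, hG, hGd, rfl⟩
    exact (eq_of_le_of_finrank_le hle this).ge
  · have htop : ∀ F ∈ 𝓖, F = ⊤ := by
      intro F hF
      obtain ⟨r, hr, -, rfl⟩ := h𝓖 hF
      rcases hr.eq_or_lt with rfl | h
      · exact LinearMap.range_eq_top.2 fun x => ⟨x, M.map_refl _ x⟩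
      · exact absurd ⟨_, hF, hM h⟩ hfd
    obtain ⟨F, hF⟩ := hne
    exact ⟨F, hF, fun G hG => (htop F hF).trans_le (htop G hG).ge⟩

/-- Kernels shrink as the target index grows towards `n`, and a non-empty set of integers bounded
above has a greatest element. This is where sampling along `ℤ` matters; tameness plays no role. -/
theorem wellOrderedChain_kernelChain {σ : ℤ → ℝ} (hσ : StrictMono σ) (n : ℤ) :
    WellOrderedChain (kernelChain M (Set.range σ) (σ n)) := by
  rintro 𝓖 h𝓖 ⟨F₀, hF₀⟩
  obtain ⟨m, ⟨hm, hmG⟩, hmax⟩ := Int.exists_greatest_of_bdd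
    (P := fun m => ∃ h : m ≤ n, LinearMap.ker (M.map (hσ.monotone h)) ∈ 𝓖)
    ⟨n, fun m hm => hm.1⟩ (by
      obtain ⟨_, hr, ⟨m, rfl⟩, rfl⟩ := h𝓖 hF₀
      exact ⟨m, hσ.le_iff_le.1 hr, hF₀⟩)
  refine ⟨_, hmG, fun G hG => ?_⟩
  obtain ⟨_, hr, ⟨k, rfl⟩, rfl⟩ := h𝓖 hG
  exact ker_map_anti (hσ.monotone (hmax k ⟨hσ.le_iff_le.1 hr, hG⟩)) (hσ.monotone hm)

/-- A q-tame persistence module has matched bases along an increasing sequence of parameters. -/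
theorem exists_matched_bases_int (hM : M.IsQTame) {σ : ℤ → ℝ} (hσ : StrictMono σ) :
    ∃ B : ∀ n, Set (M.V (σ n)), (∀ n, LinearIndepOn K id (B n) ∧ span K (B n) = ⊤) ∧
      ∀ m n (h : m ≤ n), IsMatched (M.map (hσ.monotone h)) (B n) (B m) := by
  let D := Set.range σ
  have hD : ∀ n, σ n ∈ D := fun n => ⟨n, rfl⟩
  -- Both kinds of adaptedness are needed only here: the recursion to the right carries images and
  -- the one to the left carries kernels. The left recursion starts at index `-1 = Int.negSucc 0`.
  obtain ⟨B₀, hK, hI⟩ := exists_isAdaptedBasis_both (wellOrderedChain_kernelChain (M := M) hσ 0)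
    (wellOrderedChain_imageChain hM D (σ 0))
  choose R hR using fun (n : ℕ) (B : {B : Set (M.V (σ (Int.ofNat n))) //
      IsAdaptedBasis (imageChain M D (σ (Int.ofNat n))) ⊤ B}) =>
    exists_isMatched_right (hσ.monotone (show Int.ofNat n ≤ Int.ofNat (n + 1) from
      Int.ofNat_le.2 n.le_succ)) (hD _) (wellOrderedChain_imageChain hM D _) B.2
  choose L hL using fun (n : ℕ) (B : {B : Set (M.V (σ (Int.negSucc n))) //
      IsAdaptedBasis (kernelChain M D (σ (Int.negSucc n))) ⊤ B}) =>
    exists_isMatched_left (hσ.monotone (show Int.negSucc (n + 1) ≤ Int.negSucc n by omega)) (hD _)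
      (wellOrderedChain_kernelChain hσ _) B.2
  obtain ⟨L₀, hL₀, hL₀m⟩ := exists_isMatched_left
    (hσ.monotone (show Int.negSucc 0 ≤ 0 by omega)) (hD _) (wellOrderedChain_kernelChain hσ _) hK
  let right : ∀ n : ℕ, {B : Set (M.V (σ (Int.ofNat n))) //
      IsAdaptedBasis (imageChain M D (σ (Int.ofNat n))) ⊤ B} :=
    fun n => Nat.rec ⟨B₀, hI⟩ (fun n B => ⟨R n B, (hR n B).1⟩) n
  let left : ∀ n : ℕ, {B : Set (M.V (σ (Int.negSucc n))) //
      IsAdaptedBasis (kernelChain M D (σ (Int.negSucc n))) ⊤ B} :=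
    fun n => Nat.rec ⟨L₀, hL₀⟩ (fun n B => ⟨L n B, (hL n B).1⟩) n
  let B : ∀ n : ℤ, Set (M.V (σ n)) := fun n =>
    match n with
    | Int.ofNat n => (right n).1
    | Int.negSucc n => (left n).1
  have hstep : ∀ n m (h : m ≤ n), n = m + 1 → IsMatched (M.map (hσ.monotone h)) (B n) (B m) := by
    rintro n (m | _ | m) h rfl
    · exact (hR m (right m)).2
    · exact hL₀m
    · exact (hL m (left m)).2
  refine ⟨B, ?_, fun m n h => ?_⟩
  · rintro (n | n)
    · exact ⟨(right n).2.linearIndepOn, (right n).2.span_eq⟩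
    · exact ⟨(left n).2.linearIndepOn, (left n).2.span_eq⟩
  · induction n, h using Int.leInduction with
    | base =>
      exact ⟨fun b hb _ => (M.map_refl _ b).symm ▸ hb,
        fun b _ b' _ h _ => by rwa [M.map_refl, M.map_refl] at h⟩
    | succ n h ih =>
      have hc := ih.comp (hstep (n + 1) n (by omega) rfl)
      have he : M.map (hσ.monotone h) ∘ₗ M.map (hσ.monotone (by omega : n ≤ n + 1)) =
          M.map (hσ.monotone (by omega : m ≤ n + 1)) :=
        LinearMap.ext fun x => (M.map_trans _ _ x).symm
      rwa [he] at hc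

end MatchedBases

/-! ### Barcodes from matched bases -/

section MatchedFamily

variable {K : Type v} [Field K]

/-- Bases of all the vector spaces of a persistence module that are compatible with the transition
maps. -/
structure MatchedFamily (M : PersistenceModule.{v, w} K) where
  /-- the basis at each parameter -/
  B : ∀ t, Set (M.V t)
  linearIndepOn : ∀ t, LinearIndepOn K id (B t)
  span_eq_top : ∀ t, span K (B t) = ⊤
  isMatched : ∀ {s t : ℝ} (h : s ≤ t), IsMatched (M.map h) (B t) (B s)

section Transport

variable {M : PersistenceModule.{v, w} K}

/-- If a monotone `ρ` moves each parameter only where `M` is constant, then `M` is isomorphic to its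
pullback along `ρ`. -/
theorem exists_equiv_of_monotone {ρ : ℝ → ℝ} (hρ : Monotone ρ)
    (h₁ : ∀ t (h : ρ t ≤ t), Function.Bijective (M.map h))
    (h₂ : ∀ t (h : t ≤ ρ t), Function.Bijective (M.map h)) :
    ∃ e : ∀ t, M.V t ≃ₗ[K] M.V (ρ t), ∀ {s t : ℝ} (h : s ≤ t) (x : M.V t),
      e s (M.map h x) = M.map (hρ h) (e t x) := by
  have hex : ∀ t, ∃ e : M.V t ≃ₗ[K] M.V (ρ t), (∀ (h : ρ t ≤ t) x, e x = M.map h x) ∧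
      ∀ (h : t ≤ ρ t) x, M.map h (e x) = x := fun t => by
    by_cases h : ρ t ≤ t
    · refine ⟨LinearEquiv.ofBijective _ (h₁ t h), fun _ x => rfl, fun h' x => ?_⟩
      exact (M.map_trans h' h x).symm.trans (M.map_refl t x)
    · refine ⟨(LinearEquiv.ofBijective _ (h₂ t (not_le.1 h).le)).symm, fun h' => absurd h' h,
        fun h' x => ?_⟩
      exact (LinearEquiv.ofBijective _ (h₂ t h')).apply_symm_apply x
  choose e he₁ he₂ using hex
  refine ⟨e, fun {s t} h x => ?_⟩
  rcases le_total (ρ s) s with hs | hs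
  · rw [he₁ s hs, ← M.map_trans]
    rcases le_total (ρ t) t with ht | ht
    · rw [he₁ t ht, ← M.map_trans]
    · conv_lhs => rw [← he₂ t ht x]
      rw [← M.map_trans]
  · apply (h₂ s hs).1
    rw [he₂ s hs, ← M.map_trans]
    rcases le_total (ρ t) t with ht | ht
    · rw [he₁ t ht, ← M.map_trans]
    · conv_lhs => rw [← he₂ t ht x]
      rw [← M.map_trans]

/-- Matched bases along the sample points are transported to all parameters by the natural
isomorphism with the pullback along `σ ∘ r`. -/
theorem exists_matchedFamily (hM : M.IsQTame) {σ : ℤ → ℝ} (hσ : StrictMono σ) {r : ℝ → ℤ}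
    (hr : Monotone r) (h₁ : ∀ t (h : σ (r t) ≤ t), Function.Bijective (M.map h))
    (h₂ : ∀ t (h : t ≤ σ (r t)), Function.Bijective (M.map h)) : Nonempty (MatchedFamily M) := by
  obtain ⟨B, hB, hm⟩ := exists_matched_bases_int hM hσ
  obtain ⟨e, he⟩ := exists_equiv_of_monotone (hσ.monotone.comp hr) h₁ h₂
  have himage : ∀ t, (e t).symm '' B (r t) = e t ⁻¹' B (r t) := fun t =>
    (e t).symm.toEquiv.image_eq_preimage_symm _
  refine ⟨⟨fun t => e t ⁻¹' B (r t), fun t => ?_, fun t => ?_, fun {s t} h => ⟨?_, ?_⟩⟩⟩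
  · rw [← himage]
    exact (hB (r t)).1.image (f := (e t).symm.toLinearMap) (by simp)
  · rw [← himage]
    have := map_span (e t).symm.toLinearMap (B (r t))
    rw [(hB (r t)).2, Submodule.map_top, LinearEquiv.range] at this
    exact this.symm
  · intro b hb hne
    have hne' : M.map (hσ.monotone (hr h)) (e t b) ≠ 0 := fun h0 => hne
      ((e s).map_eq_zero_iff.1 ((he h b).trans h0))
    change e s (M.map h b) ∈ B (r s)
    rw [he h]
    exact (hm _ _ (hr h)).map_mem _ hb hne'
  · intro b hb b' hb' heq hne
    have hne' : M.map (hσ.monotone (hr h)) (e t b) ≠ 0 := fun h0 => hne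
      ((e s).map_eq_zero_iff.1 ((he h b).trans h0))
    exact (e t).injective ((hm _ _ (hr h)).injOn _ hb _ hb'
      ((he h b).symm.trans ((congrArg (e s) heq).trans (he h b'))) hne')

end Transport

namespace MatchedFamily

variable {M : PersistenceModule.{v, max v w} K} (F : MatchedFamily M)

theorem ne_zero {t : ℝ} (b : F.B t) : (b : M.V t) ≠ 0 :=
  (F.linearIndepOn t).ne_zero b.2

/-- Two basis vectors belong to the same bar if one is mapped to the other. -/
def Rel (x y : Σ t, F.B t) : Prop :=
  (∃ h : x.1 ≤ y.1, M.map h y.2 = (x.2 : M.V x.1)) ∨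
    ∃ h : y.1 ≤ x.1, M.map h x.2 = (y.2 : M.V y.1)

theorem rel_iff {x y : Σ t, F.B t} (h : x.1 ≤ y.1) :
    F.Rel x y ↔ M.map h y.2 = (x.2 : M.V x.1) := by
  refine ⟨?_, fun h' => Or.inl ⟨h, h'⟩⟩
  rintro (⟨_, h'⟩ | ⟨h₂, h'⟩)
  · exact h'
  · rw [← h', ← M.map_trans, M.map_refl]

theorem Rel.symm {x y : Σ t, F.B t} (h : F.Rel x y) : F.Rel y x := Or.symm h

/-- The essential case is a middle vector at the smallest parameter: `x` and the restriction of `z`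
are basis vectors with the same non-zero image there, and matched maps are injective on such
vectors. -/
theorem Rel.trans {x y z : Σ t, F.B t} (hxy : F.Rel x y) (hyz : F.Rel y z) : F.Rel x z := by
  wlog hxz : x.1 ≤ z.1 generalizing x z
  · exact (this hyz.symm hxy.symm (not_le.1 hxz).le).symm
  rw [F.rel_iff hxz]
  rcases le_total x.1 y.1 with h₁ | h₁ <;> rcases le_total y.1 z.1 with h₂ | h₂
  · rw [← (F.rel_iff h₁).1 hxy, ← (F.rel_iff h₂).1 hyz, ← M.map_trans]
  · rw [← (F.rel_iff h₁).1 hxy, ← (F.rel_iff h₂).1 hyz.symm, ← M.map_trans]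
  · have hx := (F.rel_iff h₁).1 hxy.symm
    have hz := (F.rel_iff h₂).1 hyz
    rw [M.map_trans h₁ hxz] at hz
    have hne : M.map hxz z.2 ≠ 0 := fun h0 => F.ne_zero y.2 (by rw [← hz, h0, map_zero])
    exact (F.isMatched h₁).injOn _ ((F.isMatched hxz).map_mem _ z.2.2 hne) _ x.2.2
      (hz.trans hx.symm) (hz ▸ F.ne_zero y.2)
  · have hx := (F.rel_iff h₁).1 hxy.symm
    have hz := (F.rel_iff h₂).1 hyz.symm
    rw [← hz, ← hx, ← M.map_trans, ← M.map_trans, M.map_refl]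

/-- The equivalence relation whose classes are the bars. -/
def barSetoid : Setoid (Σ t, F.B t) where
  r := F.Rel
  iseqv := ⟨fun _ => Or.inl ⟨le_rfl, M.map_refl _ _⟩, fun h => h.symm,
    fun hxy hyz => hxy.trans _ hyz⟩

/-- The index set of the bars. -/
abbrev BarIndex : Type (max v w) := Quotient F.barSetoid

variable {F} in
/-- The bar of a basis vector. -/
def barOf {t : ℝ} (b : F.B t) : F.BarIndex := Quotient.mk _ ⟨t, b⟩

theorem barOf_eq_iff {s t : ℝ} (h : s ≤ t) (b : F.B s) (b' : F.B t) :
    barOf b = barOf b' ↔ M.map h b' = (b : M.V s) :=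
  Quotient.eq.trans (F.rel_iff (x := ⟨s, b⟩) (y := ⟨t, b'⟩) h)

theorem barOf_injective (t : ℝ) : Function.Injective (barOf (F := F) (t := t)) := fun b b' h => by
  have := (F.barOf_eq_iff le_rfl b b').1 h
  rw [M.map_refl] at this
  exact Subtype.ext this.symm

/-- The set of parameters at which a bar has a basis vector. -/
def bar (l : F.BarIndex) : Set ℝ := {t | ∃ b : F.B t, barOf b = l}

theorem bar_nonempty (l : F.BarIndex) : (F.bar l).Nonempty := by
  obtain ⟨⟨t, b⟩, rfl⟩ := Quotient.exists_rep l
  exact ⟨t, b, rfl⟩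

theorem bar_ordConnected (l : F.BarIndex) : (F.bar l).OrdConnected := by
  refine ⟨?_⟩
  rintro s ⟨b, rfl⟩ t ⟨b', h'⟩ r ⟨hsr, hrt⟩
  have hb := (F.barOf_eq_iff (hsr.trans hrt) b b').1 h'.symm
  rw [M.map_trans hsr hrt] at hb
  have hne : M.map hrt b' ≠ 0 := fun h0 => F.ne_zero b (by rw [← hb, h0, map_zero])
  exact ⟨⟨_, (F.isMatched hrt).map_mem _ b'.2 hne⟩, ((F.barOf_eq_iff hsr b _).2 hb).symm⟩

open Classical in
/-- The basis vector of a bar at `t`, or zero if the bar does not contain `t`. -/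
def gen (l : F.BarIndex) (t : ℝ) : M.V t := if h : t ∈ F.bar l then (h.choose : M.V t) else 0

theorem gen_barOf {t : ℝ} (b : F.B t) : F.gen (barOf b) t = b := by
  have h : t ∈ F.bar (barOf b) := ⟨b, rfl⟩
  rw [gen, dif_pos h, F.barOf_injective t h.choose_spec]

theorem map_gen {s t : ℝ} (h : s ≤ t) {l : F.BarIndex} (ht : t ∈ F.bar l) :
    M.map h (F.gen l t) = F.gen l s := by
  obtain ⟨b, rfl⟩ := ht
  rw [gen_barOf]
  by_cases hs : s ∈ F.bar (barOf b)
  · obtain ⟨b', hb'⟩ := hs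
    rw [← hb', gen_barOf]
    exact (F.barOf_eq_iff h b' b).1 hb'
  · rw [gen, dif_neg hs]
    by_contra hne
    exact hs ⟨⟨_, (F.isMatched h).map_mem _ b.2 hne⟩, (F.barOf_eq_iff h _ b).2 rfl⟩

open PersistenceModule Classical

/-- The map from the direct sum of interval modules at `t`. -/
def fromSum (t : ℝ) : (⨁ l, intervalSpace K (F.bar l) t) →ₗ[K] M.V t :=
  DirectSum.toModule K _ _ fun l =>
    (LinearMap.toSpanSingleton K (M.V t) (F.gen l t)).comp (intervalSpace K (F.bar l) t).subtype

theorem fromSum_lof (t : ℝ) (l : F.BarIndex) (x : intervalSpace K (F.bar l) t) :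
    F.fromSum t (DirectSum.lof K _ (fun l => intervalSpace K (F.bar l) t) l x) =
      (x : K) • F.gen l t := by
  rw [fromSum, DirectSum.toModule_lof]
  rfl

/-- The basis at `t`. -/
def basis (t : ℝ) : Module.Basis (F.B t) K (M.V t) :=
  Module.Basis.mk (v := fun b : F.B t => (b : M.V t)) (F.linearIndepOn t)
    (by rw [Subtype.range_coe, F.span_eq_top])

theorem basis_apply {t : ℝ} (b : F.B t) : F.basis t b = b := Module.Basis.mk_apply _ _ b

/-- The unit vector of a bar that contains `t`. -/
def unitVec {t : ℝ} (b : F.B t) : intervalSpace K (F.bar (barOf b)) t :=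
  ⟨1, fun h => absurd ⟨b, rfl⟩ h⟩

/-- The map to the direct sum of interval modules at `t`. -/
def toSum (t : ℝ) : M.V t →ₗ[K] ⨁ l, intervalSpace K (F.bar l) t :=
  (F.basis t).constr K fun b =>
    DirectSum.lof K _ (fun l => intervalSpace K (F.bar l) t) (barOf b) (F.unitVec b)

theorem toSum_coe {t : ℝ} (b : F.B t) : F.toSum t b =
    DirectSum.lof K _ (fun l => intervalSpace K (F.bar l) t) (barOf b) (F.unitVec b) := by
  have := (F.basis t).constr_basis K (fun b =>
    DirectSum.lof K _ (fun l => intervalSpace K (F.bar l) t) (barOf b) (F.unitVec b)) b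
  rwa [basis_apply] at this

/-- The isomorphism with the direct sum of interval modules at `t`. -/
def sumEquiv (t : ℝ) : M.V t ≃ₗ[K] ⨁ l, intervalSpace K (F.bar l) t :=
  LinearEquiv.ofLinearMap (F.toSum t) (F.fromSum t)
    (DirectSum.linearMap_ext K fun l => LinearMap.ext fun x => by
      change F.toSum t (F.fromSum t (DirectSum.lof K _ _ l x)) = DirectSum.lof K _ _ l x
      rw [fromSum_lof]
      by_cases ht : t ∈ F.bar l
      · obtain ⟨b, rfl⟩ := ht
        rw [gen_barOf, map_smul, toSum_coe, ← map_smul]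
        congr 1
        exact Subtype.ext (mul_one (x : K))
      · have hx : x = 0 := Subtype.ext (x.2 ht)
        simp [hx])
    ((F.basis t).ext fun b => by
      rw [LinearMap.comp_apply, basis_apply, toSum_coe, fromSum_lof, gen_barOf]
      exact one_smul K _)

/-- Matched bases give an interval decomposition. -/
def barcode : M.Barcode where
  ι := F.BarIndex
  bar := F.bar
  nonempty := F.bar_nonempty
  ordConnected := F.bar_ordConnected
  iso :=
    { equiv := F.sumEquiv
      naturality := fun {s t} h x => by
        let N := directSum fun l => intervalModule K (F.bar l) (F.bar_ordConnected l)
        -- Naturality is checked for the inverse map, where it can be tested on one summand at a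
        -- time.
        have key : (M.map h).comp (F.fromSum t) = (F.fromSum s).comp (N.map h) := by
          refine DirectSum.linearMap_ext K fun l => LinearMap.ext fun x => ?_
          have hlmap := DirectSum.lmap_lof
            (fun l => (intervalModule K (F.bar l) (F.bar_ordConnected l)).map h) l x
          refine Eq.trans ?_ (congrArg (F.fromSum s) hlmap).symm
          change M.map h (F.fromSum t
            (DirectSum.lof K _ (fun l => intervalSpace K (F.bar l) t) l x)) = _
          rw [fromSum_lof, map_smul]
          refine Eq.trans ?_ (F.fromSum_lof s l _).symm
          change _ = (if s ∈ F.bar l then (x : K) else 0) • F.gen l s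
          by_cases ht : t ∈ F.bar l
          · rw [F.map_gen h ht]
            by_cases hs : s ∈ F.bar l
            · rw [if_pos hs]
            · rw [gen, dif_neg hs, smul_zero, smul_zero]
          · have hx : (x : K) = 0 := x.2 ht
            simp [hx]
        refine (F.sumEquiv s).eq_symm_apply.1 (Eq.trans ?_
          (LinearMap.congr_fun key (F.toSum t x)))
        exact congrArg (M.map h) ((F.sumEquiv t).symm_apply_apply x).symm }

end MatchedFamily

end MatchedFamily

/-! ### Locally finite sets of critical parameters -/

section Discretization

theorem exists_strictMono_enumeration {C : Set ℝ} (hC : ∀ a b, (C ∩ Set.Icc a b).Finite) :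
    ∃ e : ℤ → ℝ, StrictMono e ∧ C ⊆ Set.range e ∧ (∀ t, ∃ k, e k ≤ t) ∧ ∀ t, ∃ k, t ≤ e k := by
  -- Adding the integers keeps the set locally finite and makes it unbounded in both directions, so
  -- that its order type is that of `ℤ`.
  let E : Set ℝ := C ∪ Set.range ((↑) : ℤ → ℝ)
  have hmem : ∀ k : ℤ, (k : ℝ) ∈ E := fun k => Or.inr ⟨k, rfl⟩
  have hfin : ∀ a b, (E ∩ Set.Icc a b).Finite := fun a b => by
    rw [Set.union_inter_distrib_right]
    refine (hC a b).union (((Set.finite_Icc ⌈a⌉ ⌊b⌋).image ((↑) : ℤ → ℝ)).subset ?_)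
    rintro _ ⟨⟨k, rfl⟩, h₁, h₂⟩
    exact ⟨k, ⟨Int.ceil_le.2 h₁, Int.le_floor.2 h₂⟩, rfl⟩
  let _ : LocallyFiniteOrder E := LocallyFiniteOrder.ofFiniteIcc fun a b =>
    Set.Finite.of_finite_image ((hfin a b).subset (by
      rintro _ ⟨x, hx, rfl⟩
      exact ⟨x.2, hx⟩)) Subtype.val_injective.injOn
  let _ : SuccOrder E := LinearLocallyFiniteOrder.succOrder E
  let _ : PredOrder E := LinearLocallyFiniteOrder.predOrder E
  have : Nonempty E := ⟨⟨_, hmem 0⟩⟩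
  have : NoMaxOrder E := ⟨fun x => ⟨⟨_, hmem (⌊(x : ℝ)⌋ + 1)⟩, by
    change (x : ℝ) < ((⌊(x : ℝ)⌋ + 1 : ℤ) : ℝ)
    push_cast
    exact Int.lt_floor_add_one _⟩⟩
  have : NoMinOrder E := ⟨fun x => ⟨⟨_, hmem (⌈(x : ℝ)⌉ - 1)⟩, by
    change ((⌈(x : ℝ)⌉ - 1 : ℤ) : ℝ) < (x : ℝ)
    push_cast
    linarith [Int.ceil_lt_add_one (x : ℝ)]⟩⟩
  let φ : E ≃o ℤ := orderIsoIntOfLinearSuccPredArch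
  have hφ : ∀ x (hx : x ∈ E), ((φ.symm (φ ⟨x, hx⟩) : E) : ℝ) = x := fun x hx => by
    rw [φ.symm_apply_apply]
  refine ⟨fun k => φ.symm k, fun a b h => φ.symm.strictMono h,
    fun x hx => ⟨φ ⟨x, Or.inl hx⟩, hφ x _⟩, fun t => ⟨φ ⟨_, hmem ⌊t⌋⟩, ?_⟩,
    fun t => ⟨φ ⟨_, hmem ⌈t⌉⟩, ?_⟩⟩
  · exact (hφ _ _).trans_le (Int.floor_le t)
  · exact (Int.le_ceil t).trans_eq (hφ _ _).symm

/-- The strata of a locally finite subset `C` of the line, i.e. its points and the intervals between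
them, are numbered by a monotone map `r`, and `σ` chooses a point of each stratum. -/
theorem exists_strata {C : Set ℝ} (hC : ∀ a b, (C ∩ Set.Icc a b).Finite) :
    ∃ (σ : ℤ → ℝ) (r : ℝ → ℤ), StrictMono σ ∧ Monotone r ∧
      ∀ t, σ (r t) = t ∨ ∃ a b, Disjoint (Set.Ioo a b) C ∧ t ∈ Set.Ioo a b ∧
        σ (r t) ∈ Set.Ioo a b := by
  obtain ⟨e, he, hCe, hlow, hup⟩ := exists_strictMono_enumeration hC
  have hk : ∀ t, ∃ k, ∀ m, e m ≤ t ↔ m ≤ k := fun t => by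
    obtain ⟨k, hk, hmax⟩ := Int.exists_greatest_of_bdd (P := fun k => e k ≤ t)
      (let ⟨k, hk⟩ := hup t; ⟨k, fun m hm => he.le_iff_le.1 (hm.trans hk)⟩) (hlow t)
    exact ⟨k, fun m => ⟨hmax m, fun h => (he.monotone h).trans hk⟩⟩
  have hl : ∀ t, ∃ k, ∀ m, t ≤ e m ↔ k ≤ m := fun t => by
    obtain ⟨k, hk, hmin⟩ := Int.exists_least_of_bdd (P := fun k => t ≤ e k)
      (let ⟨k, hk⟩ := hlow t; ⟨k, fun m hm => he.le_iff_le.1 (hk.trans hm)⟩) (hup t)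
    exact ⟨k, fun m => ⟨hmin m, fun h => hk.trans (he.monotone h)⟩⟩
  choose p hp using hk
  choose q hq using hl
  -- Even indices `2k` give the point `e k`, odd indices `2k + 1` the midpoint of the gap between `e
  -- k` and `e (k + 1)`. With `p t` the last index at or below `t` and `q t` the first at or above
  -- it, `p t + q t` is the number of the stratum of `t`.
  let σ : ℤ → ℝ := fun n => (e (n / 2) + e ((n + 1) / 2)) / 2
  have hσ_even : ∀ k, σ (k + k) = e k := fun k => by
    have h₁ : (k + k) / 2 = k := by omega
    have h₂ : (k + k + 1) / 2 = k := by omega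
    simp only [σ, h₁, h₂]
    ring
  have hσ_odd : ∀ k, σ (k + (k + 1)) = (e k + e (k + 1)) / 2 := fun k => by
    have h₁ : (k + (k + 1)) / 2 = k := by omega
    have h₂ : (k + (k + 1) + 1) / 2 = k + 1 := by omega
    simp only [σ, h₁, h₂]
  refine ⟨σ, fun t => p t + q t, strictMono_int_of_lt_succ fun n => ?_, fun s t h => ?_,
    fun t => ?_⟩
  · have hlt : e (n / 2) < e ((n + 1 + 1) / 2) := he (by omega)
    simp only [σ]
    linarith
  · refine add_le_add ((hp t _).1 (((hp s _).2 le_rfl).trans h)) ?_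
    exact (hq s _).1 (h.trans ((hq t _).2 le_rfl))
  · have h₁ : e (p t) ≤ t := (hp t _).2 le_rfl
    have h₂ : t ≤ e (q t) := (hq t _).2 le_rfl
    have h₃ : p t ≤ q t := he.le_iff_le.1 (h₁.trans h₂)
    rcases h₃.eq_or_lt with h | h
    · refine Or.inl ?_
      change σ (p t + q t) = t
      rw [← h, hσ_even]
      exact le_antisymm h₁ (h ▸ h₂)
    · have hq' : q t = p t + 1 := by
        refine le_antisymm ((hq t _).1 (le_of_not_ge fun h' => ?_)) h
        have := (hp t _).1 h'
        omega
      have hlt : e (p t) < e (p t + 1) := he (by omega)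
      refine Or.inr ⟨e (p t), e (p t + 1), ?_, ⟨lt_of_le_of_ne h₁ fun h' => ?_,
        lt_of_le_of_ne (hq' ▸ h₂) fun h' => ?_⟩, ?_⟩
      · rw [Set.disjoint_left]
        intro x hx hxC
        obtain ⟨k, rfl⟩ := hCe hxC
        have := he.lt_iff_lt.1 hx.1
        have := he.lt_iff_lt.1 hx.2
        omega
      · have := (hq t _).1 h'.ge
        omega
      · have := (hp t _).1 h'.ge
        omega
      · change σ (p t + q t) ∈ _
        rw [hq', hσ_odd]
        constructor <;> linarith

variable {K : Type v} [Field K]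

/-- The transition maps throughout a neighbourhood of `t` are bijective. -/
def PersistenceModule.IsRegularAt (M : PersistenceModule.{v, w} K) (t : ℝ) : Prop :=
  ∃ ε > 0, ∀ ⦃s s' : ℝ⦄ (h : s ≤ s'), t - ε < s → s' < t + ε → Function.Bijective (M.map h)

/-- Local bijectivity spreads over the interval by connectedness: two-out-of-three for bijections
makes the relation of being joined by a bijective transition map, in whichever direction exists,
transitive. -/
theorem bijective_of_isRegularAt {M : PersistenceModule.{v, w} K} {a b : ℝ}
    (hM : ∀ t ∈ Set.Ioo a b, M.IsRegularAt t) {s t : ℝ} (h : s ≤ t) (hs : s ∈ Set.Ioo a b)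
    (ht : t ∈ Set.Ioo a b) : Function.Bijective (M.map h) := by
  let P : ℝ → ℝ → Prop := fun x y => (∀ h : x ≤ y, Function.Bijective (M.map h)) ∧
    ∀ h : y ≤ x, Function.Bijective (M.map h)
  have hcomp : ∀ {r s t : ℝ} (hrs : r ≤ s) (hst : s ≤ t),
      ⇑(M.map (hrs.trans hst)) = M.map hrs ∘ M.map hst := fun hrs hst =>
    funext (M.map_trans hrs hst)
  have h₁ : ∀ {r s t : ℝ} (hrs : r ≤ s) (hst : s ≤ t), Function.Bijective (M.map hrs) →
      Function.Bijective (M.map hst) → Function.Bijective (M.map (hrs.trans hst)) :=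
    fun hrs hst h h' => hcomp hrs hst ▸ h.comp h'
  have h₂ : ∀ {r s t : ℝ} (hrs : r ≤ s) (hst : s ≤ t), Function.Bijective (M.map hrs) →
      Function.Bijective (M.map (hrs.trans hst)) → Function.Bijective (M.map hst) :=
    fun hrs hst h h' => by
      rw [hcomp hrs hst] at h'
      exact (Function.Bijective.of_comp_iff' h _).1 h'
  have h₃ : ∀ {r s t : ℝ} (hrs : r ≤ s) (hst : s ≤ t), Function.Bijective (M.map hst) →
      Function.Bijective (M.map (hrs.trans hst)) → Function.Bijective (M.map hrs) :=
    fun hrs hst h h' => by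
      rw [hcomp hrs hst] at h'
      exact (Function.Bijective.of_comp_iff _ h).1 h'
  have htrans : ∀ x y z, P x y → P y z → ∀ h : x ≤ z, Function.Bijective (M.map h) := by
    intro x y z hxy hyz h
    rcases le_total x y with hx | hx
    · rcases le_total y z with hz | hz
      · exact h₁ hx hz (hxy.1 hx) (hyz.1 hz)
      · exact h₃ h hz (hyz.2 hz) (hxy.1 hx)
    · exact h₂ hx h (hxy.2 hx) (hyz.1 (hx.trans h))
  have hsymm : ∀ x y, P x y → P y x := fun x y h => ⟨h.2, h.1⟩
  have hP : P s t := by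
    refine isPreconnected_Ioo.induction₂ P (fun x hx => ?_)
      (fun x y z _ _ _ hxy hyz => ⟨htrans x y z hxy hyz,
        htrans z y x (hsymm _ _ hyz) (hsymm _ _ hxy)⟩) (fun x y _ _ => hsymm x y) hs ht
    obtain ⟨ε, hε, hreg⟩ := hM x hx
    refine Filter.Eventually.filter_mono nhdsWithin_le_nhds ?_
    filter_upwards [Ioo_mem_nhds (sub_lt_self x hε) (lt_add_of_pos_right x hε)] with y hy
    exact ⟨fun h => hreg h (sub_lt_self x hε) hy.2,
      fun h => hreg h hy.1 (lt_add_of_pos_right x hε)⟩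
  exact hP.1 h

/-- A q-tame persistence module that is locally constant away from a locally finite set of
parameters has a barcode. -/
theorem nonempty_barcode {M : PersistenceModule.{v, max v w} K} (hM : M.IsQTame) {C : Set ℝ}
    (hC : ∀ a b, (C ∩ Set.Icc a b).Finite) (hreg : ∀ t ∉ C, M.IsRegularAt t) :
    Nonempty M.Barcode := by
  obtain ⟨σ, r, hσ, hr, hstrata⟩ := exists_strata hC
  have hrefl : ∀ {s t : ℝ} (h : s ≤ t), s = t → Function.Bijective (M.map h) := by
    rintro s _ h rfl
    have : ⇑(M.map h) = id := funext (M.map_refl s)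
    rw [this]
    exact Function.bijective_id
  have hbij : ∀ {a b : ℝ}, Disjoint (Set.Ioo a b) C → ∀ t ∈ Set.Ioo a b, M.IsRegularAt t :=
    fun hd t ht => hreg t fun htC => Set.disjoint_left.1 hd ht htC
  obtain ⟨F⟩ := exists_matchedFamily hM hσ hr
    (fun t h => by
      rcases hstrata t with h' | ⟨a, b, hd, ht, hs⟩
      · exact hrefl h h'
      · exact bijective_of_isRegularAt (hbij hd) h hs ht)
    (fun t h => by
      rcases hstrata t with h' | ⟨a, b, hd, ht, hs⟩
      · exact hrefl h h'.symm
      · exact bijective_of_isRegularAt (hbij hd) h ht hs)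
  exact ⟨F.barcode⟩

end Discretization

/-! ### Tameness and local constancy of the cup modules -/

section CupModule

variable {K : Type v} [Field K] {S T : SSet.{u}}

theorem cohRingMap_apply (φ : S ⟶ T) (x : CohRing K T) (p : ℕ) :
    cohRingMap K φ x p = cohMap K φ p (x p) := by
  induction x using DirectSum.induction_on with
  | zero => simp
  | of q y =>
    have h := cohRingMap_lof K φ q y
    rw [DirectSum.lof_eq_of, DirectSum.lof_eq_of] at h
    rw [h]
    by_cases hpq : q = p
    · subst hpq
      simp
    · rw [DirectSum.of_eq_of_ne _ _ _ (Ne.symm hpq), DirectSum.of_eq_of_ne _ _ _ (Ne.symm hpq),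
        map_zero]
  | add x y hx hy => simp [hx, hy]

theorem cohMap_injective {φ : S ⟶ T} (h : Function.Injective (cohRingMap K φ)) (p : ℕ) :
    Function.Injective (cohMap K φ p) := fun x y hxy => by
  apply DirectSum.of_injective p
  apply h
  rw [← DirectSum.lof_eq_of K, ← DirectSum.lof_eq_of K, cohRingMap_lof, cohRingMap_lof, hxy]

theorem cohMap_surjective {φ : S ⟶ T} (h : Function.Surjective (cohRingMap K φ)) (p : ℕ) :
    Function.Surjective (cohMap K φ p) := fun y => by
  obtain ⟨x, hx⟩ := h (DirectSum.of _ p y)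
  refine ⟨x p, ?_⟩
  rw [← cohRingMap_apply, hx, DirectSum.of_eq_same]

theorem positivePart_le_map {φ : S ⟶ T} (h : Function.Surjective (cohRingMap K φ)) :
    positivePart K S ≤ (positivePart K T).map (cohRingMap K φ).toLinearMap := by
  refine iSup_le fun p => ?_
  rintro _ ⟨y, rfl⟩
  obtain ⟨x, rfl⟩ := cohMap_surjective h p y
  exact ⟨DirectSum.lof K ℕ _ p x, mem_iSup_of_mem p ⟨x, rfl⟩, cohRingMap_lof K φ p x⟩

theorem exists_mem_cupPower {φ : S ⟶ T} (h : Function.Surjective (cohRingMap K φ)) (ℓ : ℕ)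
    {y : CohRing K S} (hy : y ∈ cupPower K S ℓ) : ∃ x ∈ cupPower K T ℓ, cohRingMap K φ x = y := by
  induction hy using NonUnitalAlgebra.adjoin_induction with
  | mem y hy =>
    obtain ⟨η, hη, rfl⟩ := hy
    choose ξ hξ hξη using fun i => positivePart_le_map h (hη i)
    refine ⟨_, NonUnitalAlgebra.subset_adjoin K ⟨ξ, hξ, rfl⟩, ?_⟩
    rw [map_list_prod, List.map_ofFn]
    exact congrArg (fun f => (List.ofFn f).prod) (funext hξη)
  | add y y' _ _ hy hy' =>
    obtain ⟨x, hx, rfl⟩ := hy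
    obtain ⟨x', hx', rfl⟩ := hy'
    exact ⟨x + x', add_mem hx hx', map_add _ _ _⟩
  | zero => exact ⟨0, zero_mem _, map_zero _⟩
  | mul y y' _ _ hy hy' =>
    obtain ⟨x, hx, rfl⟩ := hy
    obtain ⟨x', hx', rfl⟩ := hy'
    exact ⟨x * x', mul_mem hx hx', map_mul _ _ _⟩
  | smul c y _ hy =>
    obtain ⟨x, hx, rfl⟩ := hy
    exact ⟨c • x, SMulMemClass.smul_mem c hx, map_smul _ _ _⟩

/-- Generators of the cup power lift to generators, which gives a preimage in the cup power of the
whole ring. Injectivity identifies it with the homogeneous preimage of degree `p`. -/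
theorem cupPowerMap_bijective {φ : S ⟶ T} (h : Function.Bijective (cohRingMap K φ)) (ℓ p : ℕ) :
    Function.Bijective (cupPowerMap K φ ℓ p) := by
  refine ⟨fun x y hxy => Subtype.ext (cohMap_injective h.1 p (congrArg Subtype.val hxy)),
    fun y => ?_⟩
  obtain ⟨x, hx, hxy⟩ := exists_mem_cupPower h.2 ℓ y.2
  obtain ⟨z, hz⟩ := cohMap_surjective h.2 p y
  have hxz : DirectSum.lof K ℕ (Coh K T) p z = x := h.1 (by rw [cohRingMap_lof, hz, hxy])
  refine ⟨⟨z, ?_⟩, Subtype.ext hz⟩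
  change DirectSum.lof K ℕ (Coh K T) p z ∈ cupPower K T ℓ
  rwa [hxz]

variable {X : ℝ ⥤ TopCat.{u}}

theorem persistentCupModule_isQTame (hX : ∀ p : ℕ, (persistentCohomology K X p).IsQTame)
    (ℓ p : ℕ+) : (persistentCupModule K X ℓ p).IsQTame := fun s t h => by
  have : FiniteDimensional K (LinearMap.range (cohMap K (singMap X h.le) p)) := hX p h
  refine Module.Finite.of_injective (M := LinearMap.range (cupPowerMap K (singMap X h.le) ℓ p))
    (N := LinearMap.range (cohMap K (singMap X h.le) p))
    ((cupPowerDeg K (sing X s) ℓ p).subtype.restrict ?_) ?_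
  · rintro _ ⟨x, rfl⟩
    exact ⟨x, rfl⟩
  · intro x y hxy
    exact Subtype.ext (Subtype.ext (congrArg
      (fun z : LinearMap.range (cohMap K (singMap X h.le) p) => (z : Coh K (sing X s) p)) hxy))

theorem isClosed_isCriticalValue : IsClosed {t : ℝ | IsCriticalValue K X t} := by
  rw [← isOpen_compl_iff, Metric.isOpen_iff]
  intro t ht
  obtain ⟨ε, hε, h⟩ := not_not.1 ht
  refine ⟨ε / 2, half_pos hε, fun t' ht' => not_not.2 ⟨ε / 2, half_pos hε, fun s s' hs h₁ h₂ => ?_⟩⟩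
  have := abs_lt.1 (Metric.mem_ball.1 ht')
  exact h hs (by linarith) (by linarith)

theorem nonempty_barcode_persistentCupModule
    (hX : ∀ p : ℕ, (persistentCohomology K X p).IsQTame)
    (hC : _root_.IsDiscrete {t : ℝ | IsCriticalValue K X t}) (ℓ p : ℕ+) :
    Nonempty (persistentCupModule K X ℓ p).Barcode := by
  refine nonempty_barcode (persistentCupModule_isQTame hX ℓ p)
    (C := {t : ℝ | IsCriticalValue K X t}) (fun a b => ?_) fun t ht => ?_
  -- Discreteness alone would allow accumulation at a non-critical value; closedness excludes this
  -- and makes the set locally finite.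
  · exact (isCompact_Icc.inter_left isClosed_isCriticalValue).finite
      (hC.mono Set.inter_subset_left)
  · obtain ⟨ε, hε, h⟩ := not_not.1 ht
    exact ⟨ε, hε, fun s s' hs h₁ h₂ => cupPowerMap_bijective (h hs h₁ h₂) ℓ p⟩

end CupModule

/-! ### Interval modules, uniqueness of bars and non-zero transition maps -/

namespace PersistenceModule

variable {K : Type v} [Field K]

theorem intervalSpace_eq_zero {J : Set ℝ} {t : ℝ} (ht : t ∉ J) (x : intervalSpace K J t) : x = 0 :=
  Subtype.ext (x.2 ht)

theorem mem_of_ne_zero {J : Set ℝ} {t : ℝ} {x : intervalSpace K J t} (hx : x ≠ 0) : t ∈ J := by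
  by_contra ht
  exact hx (intervalSpace_eq_zero ht x)

theorem intervalModule_map_ne_zero {J : Set ℝ} (hJ : J.OrdConnected) {s t : ℝ} (h : s ≤ t)
    (hs : s ∈ J) {x : intervalSpace K J t} (hx : x ≠ 0) :
    (intervalModule K J hJ).map h x ≠ 0 := fun h0 => hx (Subtype.ext
  ((if_pos hs).symm.trans (congrArg Subtype.val h0)))

theorem exists_intervalModule_map_eq {J : Set ℝ} (hJ : J.OrdConnected) {s t : ℝ} (h : s ≤ t)
    (ht : t ∈ J) (x : (intervalModule K J hJ).V s) :
    ∃ y : (intervalModule K J hJ).V t, (intervalModule K J hJ).map h y = x := by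
  refine ⟨⟨x.1, fun h' => absurd ht h'⟩, Subtype.ext ?_⟩
  by_cases hs : s ∈ J
  · exact if_pos hs
  · exact (if_neg hs).trans (x.2 hs).symm

/-- Natural maps between the interval modules of `J` and `J'` with non-zero composition exist only
for `J = J'`. -/
theorem eq_of_natural_comp_ne_zero {J J' : Set ℝ} (hJ : J.OrdConnected) (hJ' : J'.OrdConnected)
    (α : ∀ t, (intervalModule K J hJ).V t →ₗ[K] (intervalModule K J' hJ').V t)
    (β : ∀ t, (intervalModule K J' hJ').V t →ₗ[K] (intervalModule K J hJ).V t)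
    (hα : ∀ {s t : ℝ} (h : s ≤ t) x, α s ((intervalModule K J hJ).map h x) =
      (intervalModule K J' hJ').map h (α t x))
    (hβ : ∀ {s t : ℝ} (h : s ≤ t) x, β s ((intervalModule K J' hJ').map h x) =
      (intervalModule K J hJ).map h (β t x))
    {t : ℝ} {x : (intervalModule K J hJ).V t} (hx : β t (α t x) ≠ 0) : J = J' := by
  have hne : ∀ {s : ℝ} {y : (intervalModule K J hJ).V s}, β s (α s y) ≠ 0 → s ∈ J' := fun hy =>
    mem_of_ne_zero fun h0 => hy ((congrArg (β _) h0).trans (map_zero _))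
  have hαx : α t x ≠ 0 := fun h0 => hx ((congrArg (β _) h0).trans (map_zero _))
  ext s
  refine ⟨fun hs => ?_, fun hs => by_contra fun hs' => ?_⟩
  -- A point `s ∈ J` is reached by moving `x` to `s`: elements of `K_J` restrict without vanishing
  -- inside `J`, and they lift to larger parameters in `J`. The composite stays non-zero at `s`,
  -- hence `K_J'` is non-zero there.
  · rcases le_total s t with h | h
    · refine hne (y := (intervalModule K J hJ).map h x) ?_
      rw [hα, hβ]
      exact intervalModule_map_ne_zero hJ h hs hx
    · obtain ⟨y, rfl⟩ := exists_intervalModule_map_eq hJ h hs x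
      rw [hα, hβ] at hx
      exact hne fun h0 => hx ((congrArg _ h0).trans (map_zero _))
  -- For `s ∈ J'` outside `J`, naturality would send the non-zero vector `α t x` through the zero
  -- space of `K_J` at `s`: by restriction when `s ≤ t`, and by lifting and applying `β` when `t ≤
  -- s`.
  · rcases le_total s t with h | h
    · refine intervalModule_map_ne_zero hJ' h hs hαx ?_
      rw [← hα]
      exact (congrArg (α s) (intervalSpace_eq_zero hs' _)).trans (map_zero _)
    · obtain ⟨y, hy⟩ := exists_intervalModule_map_eq hJ' h hs (α t x)
      refine hx ?_
      rw [← hy, hβ]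
      exact (congrArg _ (intervalSpace_eq_zero hs' (β s y))).trans (map_zero _)

namespace Barcode

open Classical

variable {M : PersistenceModule.{v, max v w} K}

/-- The interval module of a bar. -/
abbrev barModule (B : M.Barcode) (l : B.ι) : PersistenceModule.{v, v} K :=
  intervalModule K (B.bar l) (B.ordConnected l)

/-- The inclusion of the summand of a bar. -/
def incl (B : M.Barcode) (l : B.ι) (t : ℝ) : (B.barModule l).V t →ₗ[K] M.V t :=
  (B.iso.equiv t).symm.toLinearMap ∘ₗ DirectSum.lof K B.ι (fun l => (B.barModule l).V t) l

/-- The projection to the summand of a bar. -/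
def proj (B : M.Barcode) (l : B.ι) (t : ℝ) : M.V t →ₗ[K] (B.barModule l).V t :=
  DirectSum.component K B.ι (fun l => (B.barModule l).V t) l ∘ₗ (B.iso.equiv t).toLinearMap

variable (B : M.Barcode)

theorem proj_incl (l : B.ι) (t : ℝ) (x : (B.barModule l).V t) : B.proj l t (B.incl l t x) = x :=
  (congrArg (DirectSum.component K B.ι (fun l => (B.barModule l).V t) l)
    ((B.iso.equiv t).apply_symm_apply _)).trans
    (DirectSum.component.lof_self K (M := fun l => (B.barModule l).V t) l x)

theorem incl_map (l : B.ι) {s t : ℝ} (h : s ≤ t) (x : (B.barModule l).V t) :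
    B.incl l s ((B.barModule l).map h x) = M.map h (B.incl l t x) := by
  refine (LinearEquiv.symm_apply_eq _).2 ?_
  refine Eq.trans ?_ (B.iso.naturality h _).symm
  refine Eq.trans ?_ (congrArg ((directSum B.barModule).map h)
    ((B.iso.equiv t).apply_symm_apply _)).symm
  exact (DirectSum.lmap_lof (fun l => (B.barModule l).map h) l x).symm

theorem proj_map (l : B.ι) {s t : ℝ} (h : s ≤ t) (x : M.V t) :
    B.proj l s (M.map h x) = (B.barModule l).map h (B.proj l t x) :=
  (congrArg (DirectSum.component K B.ι (fun l => (B.barModule l).V s) l)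
    (B.iso.naturality h x)).trans (DirectSum.lmap_apply
      (fun l => (B.barModule l).map h) (B.iso.equiv t x) l)

/-- An element is the finite sum of its components in the bars, so vanishing can be tested one bar
at a time. -/
theorem eq_zero_of_proj {t : ℝ} {N : Type*} [AddCommGroup N] [Module K N] (f : M.V t →ₗ[K] N)
    {x : M.V t} (h : ∀ l, f (B.incl l t (B.proj l t x)) = 0) : f x = 0 := by
  obtain ⟨y, rfl⟩ := (B.iso.equiv t).symm.surjective x
  have hy : ∀ l, B.proj l t ((B.iso.equiv t).symm y) = (show ⨁ l, (B.barModule l).V t from y) l :=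
    fun l => congrArg (DirectSum.component K B.ι (fun l => (B.barModule l).V t) l)
      ((B.iso.equiv t).apply_symm_apply y)
  simp only [hy] at h
  have hsum := DirectSum.sum_support_of (show ⨁ l, (B.barModule l).V t from y)
  let g : (⨁ l, (B.barModule l).V t) →ₗ[K] N := f ∘ₗ (B.iso.equiv t).symm.toLinearMap
  change g (show ⨁ l, (B.barModule l).V t from y) = 0
  rw [← hsum, map_sum]
  exact Finset.sum_eq_zero fun l _ => h l

/-- The bars do not depend on the interval decomposition. -/
theorem exists_bar_eq (B B' : M.Barcode) (l : B.ι) : ∃ l', B'.bar l' = B.bar l := by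
  obtain ⟨t, ht⟩ := B.nonempty l
  let x : (B.barModule l).V t := ⟨1, fun h => absurd ht h⟩
  have hx : x ≠ 0 := fun h0 => one_ne_zero (congrArg Subtype.val h0)
  by_contra! hne
  refine hx ((B.proj_incl l t x).symm.trans (B'.eq_zero_of_proj (B.proj l t) fun l' => ?_))
  by_contra h0
  refine hne l' (eq_of_natural_comp_ne_zero (B.ordConnected l) (B'.ordConnected l')
    (fun t => B'.proj l' t ∘ₗ B.incl l t) (fun t => B.proj l t ∘ₗ B'.incl l' t)
    (fun h x => ?_) (fun h x => ?_) h0).symm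
  · exact (congrArg _ (B.incl_map l h x)).trans (B'.proj_map l' h _)
  · exact (congrArg _ (B'.incl_map l' h x)).trans (B.proj_map l h _)

/-- A transition map is non-zero if and only if there is a bar containing its endpoints. -/
theorem map_ne_zero_iff {s t : ℝ} (h : s ≤ t) :
    M.map h ≠ 0 ↔ ∃ l, Set.Icc s t ⊆ B.bar l := by
  constructor
  · intro hne
    by_contra! hl
    refine hne (LinearMap.ext fun x => B.eq_zero_of_proj (M.map h) fun l => ?_)
    rw [← B.incl_map]
    suffices (B.barModule l).map h (B.proj l t x) = 0 by
      exact (congrArg _ this).trans (map_zero _)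
    by_contra h0
    refine hl l ((B.ordConnected l).out (mem_of_ne_zero h0)
      (mem_of_ne_zero (x := B.proj l t x) fun h1 => h0 ?_))
    exact (congrArg _ h1).trans (map_zero _)
  · rintro ⟨l, hl⟩ h0
    let x : (B.barModule l).V t := ⟨1, fun h' => absurd (hl ⟨h, le_rfl⟩) h'⟩
    have hx : x ≠ 0 := fun h0 => one_ne_zero (congrArg Subtype.val h0)
    refine intervalModule_map_ne_zero (B.ordConnected l) h (hl ⟨le_rfl, h⟩) hx ?_
    rw [← B.proj_incl l s ((B.barModule l).map h x), B.incl_map, h0, LinearMap.zero_apply,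
      map_zero]

end Barcode

end PersistenceModule

/-! ### Cup-length from the bars of the cup modules -/

section CupLength

variable {K : Type v} [Field K]

theorem cupBarLength_eq {X : ℝ ⥤ TopCat.{u}}
    (B B' : ∀ ℓ p : ℕ+, (persistentCupModule K X ℓ p).Barcode) :
    cupBarLength B = cupBarLength B' := by
  have hle : ∀ (B B' : ∀ ℓ p : ℕ+, (persistentCupModule K X ℓ p).Barcode) (ℓ : ℕ+),
      cupBars B ℓ ⊆ cupBars B' ℓ := by
    rintro B B' ℓ _ ⟨p, l, rfl⟩
    exact ⟨p, (B ℓ p).exists_bar_eq (B' ℓ p) l⟩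
  have h : cupBars B = cupBars B' := funext fun ℓ => (hle B B' ℓ).antisymm (hle B' B ℓ)
  funext J
  rw [cupBarLength, cupBarLength, h]

theorem prod_ofFn_mem_pow {A : Type*} [Ring A] [Algebra K A] (P : Submodule K A) :
    ∀ {n : ℕ} (ξ : Fin n → A), (∀ i, ξ i ∈ P) → (List.ofFn ξ).prod ∈ P ^ n
  | 0, ξ, _ => by
    rw [List.ofFn_zero, List.prod_nil, pow_zero]
    exact one_le.1 le_rfl
  | n + 1, ξ, h => by
    rw [List.ofFn_succ, List.prod_cons, pow_succ']
    exact mul_mem_mul (h 0) (prod_ofFn_mem_pow P _ fun i => h i.succ)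

variable {S T : SSet.{u}} (φ : S ⟶ T)

/-- Products of `ℓ` homogeneous elements of positive degree of the image ring are the only
obstruction to the vanishing on the `ℓ`-fold product. -/
theorem cohRingMap_eq_zero_of_mem_cupPower {ℓ : ℕ}
    (h : ∀ η : Fin ℓ → (cohRingMap K φ).range,
      (∀ i, ∃ p, 1 ≤ p ∧ η i ∈ imageGrading K φ p) → (List.ofFn η).prod = 0)
    {x : CohRing K T} (hx : x ∈ cupPower K T ℓ) : cohRingMap K φ x = 0 := by
  induction hx using NonUnitalAlgebra.adjoin_induction with
  | mem x hx =>
    obtain ⟨ξ, hξ, rfl⟩ := hx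
    let H : Set (CohRing K T) := ⋃ p : ℕ+, LinearMap.range (DirectSum.lof K ℕ (Coh K T) p)
    have hH : positivePart K T = span K H := by
      rw [span_iUnion]
      simp only [span_eq, positivePart]
    have hmem := prod_ofFn_mem_pow _ ξ hξ
    rw [hH, span_pow] at hmem
    -- By multilinearity, an `ℓ`-fold product of elements of positive degree is a combination of
    -- products of homogeneous ones, to which the hypothesis applies.
    have hle : span K (H ^ ℓ) ≤ LinearMap.ker (cohRingMap K φ).toLinearMap := by
      rw [span_le]
      intro y hy
      obtain ⟨f, rfl⟩ := Set.mem_pow.1 hy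
      have h0 := h (fun i => ⟨cohRingMap K φ (f i), f i, rfl⟩) fun i => by
        obtain ⟨p, z, hz⟩ := Set.mem_iUnion.1 (f i).2
        refine ⟨p, p.2, cohMap K φ p z, ?_⟩
        rw [← cohRingMap_lof, hz]
        rfl
      have h1 := congrArg (cohRingMap K φ).range.val h0
      rw [map_list_prod, List.map_ofFn, map_zero] at h1
      change cohRingMap K φ _ = 0
      rw [map_list_prod, List.map_ofFn]
      exact h1
    exact hle hmem
  | add x y _ _ hx hy => rw [map_add, hx, hy, add_zero]
  | zero => exact map_zero _
  | mul x y _ _ hx hy => rw [map_mul, hx, zero_mul]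
  | smul c x _ hx => rw [map_smul, hx, smul_zero]

/-- A product in the image ring is the image of a homogeneous element of the cup power. Conversely,
if all such products vanish, the ring map kills the whole cup power. -/
theorem exists_prod_ne_zero_iff (ℓ : ℕ+) :
    (∃ η : Fin ℓ → (cohRingMap K φ).range,
      (∀ i, ∃ p, 1 ≤ p ∧ η i ∈ imageGrading K φ p) ∧ (List.ofFn η).prod ≠ 0) ↔
      ∃ p : ℕ+, cupPowerMap K φ ℓ p ≠ 0 := by
  constructor
  · rintro ⟨η, hη, hne⟩
    choose d hd y hy using hη
    choose ξ hξ using fun i => (η i).2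
    -- A preimage of a homogeneous element need not be homogeneous, but its component in the same
    -- degree is still a preimage.
    let z : ∀ i, Coh K T (d i) := fun i => ξ i (d i)
    have hz : ∀ i, cohRingMap K φ (DirectSum.of (Coh K T) (d i) (z i)) = η i := fun i => by
      have h₁ : cohMap K φ (d i) (z i) = y i := by
        have h₂ : DirectSum.lof K ℕ (Coh K S) (d i) (y i) = cohRingMap K φ (ξ i) :=
          (hy i).trans (hξ i).symm
        rw [← cohRingMap_apply, ← h₂, DirectSum.lof_apply]
      rw [← DirectSum.lof_eq_of K, cohRingMap_lof, h₁]
      exact hy i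
    have hprod := DirectSum.list_prod_ofFn_of_eq_dProd (Coh K T) (ℓ : ℕ) d z
    set n := (List.finRange ℓ).dProdIndex d with hn
    set w := (List.finRange ℓ).dProd d z
    -- The total degree is positive because `ℓ ≥ 1` and the first factor already has positive
    -- degree.
    have hpos : 0 < n := by
      rw [hn, List.dProdIndex_eq_map_sum]
      have h0 : d ⟨0, ℓ.2⟩ ≤ ((List.finRange ℓ).map d).sum :=
        List.single_le_sum (by simp) _ (List.mem_map_of_mem (List.mem_finRange _))
      exact (hd _).trans h0
    have hw : w ∈ cupPowerDeg K T ℓ n := by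
      change DirectSum.lof K ℕ (Coh K T) n w ∈ cupPower K T ℓ
      rw [DirectSum.lof_eq_of, ← hprod]
      exact NonUnitalAlgebra.subset_adjoin K
        ⟨_, fun i => mem_iSup_of_mem ⟨d i, hd i⟩ ⟨z i, rfl⟩, rfl⟩
    refine ⟨⟨n, hpos⟩, fun h0 => hne (Subtype.val_injective ?_)⟩
    have h1 : cohMap K φ n w = 0 :=
      congrArg Subtype.val (LinearMap.congr_fun h0 (⟨w, hw⟩ : cupPowerDeg K T ℓ n))
    have h2 : cohRingMap K φ (List.ofFn fun i => DirectSum.of (Coh K T) (d i) (z i)).prod = 0 := by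
      rw [hprod, ← DirectSum.lof_eq_of K, cohRingMap_lof, h1, map_zero]
    rw [map_list_prod, List.map_ofFn] at h2
    have h3 := map_list_prod (cohRingMap K φ).range.val (List.ofFn η)
    rw [List.map_ofFn] at h3
    refine h3.trans (Eq.trans ?_ h2)
    exact congrArg (fun f => (List.ofFn f).prod) (funext fun i => (hz i).symm)
  · rintro ⟨p, hp⟩
    by_contra! h
    refine hp (LinearMap.ext fun x => Subtype.ext ?_)
    have h0 := cohRingMap_eq_zero_of_mem_cupPower φ h x.2
    rw [cohRingMap_lof] at h0
    refine DirectSum.of_injective (β := Coh K S) p ?_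
    rw [← DirectSum.lof_eq_of K]
    exact h0.trans (map_zero _).symm

theorem persistentCupLength_eq {X : ℝ ⥤ TopCat.{u}}
    (B : ∀ ℓ p : ℕ+, (persistentCupModule K X ℓ p).Barcode) {a b : ℝ} (hab : a ≤ b) :
    persistentCupLength K X hab = ⨆ (J : Set ℝ) (_ : Set.Icc a b ⊆ J), cupBarLength B J := by
  have hiff : ∀ ℓ : ℕ+, (∃ η : Fin ℓ → (cohRingMap K (singMap X hab)).range,
      (∀ i, ∃ p, 1 ≤ p ∧ η i ∈ imageGrading K (singMap X hab) p) ∧ (List.ofFn η).prod ≠ 0) ↔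
      ∃ (p : ℕ+) (l : (B ℓ p).ι), Set.Icc a b ⊆ (B ℓ p).bar l := fun ℓ =>
    (exists_prod_ne_zero_iff (singMap X hab) ℓ).trans
      (exists_congr fun p => (B ℓ p).map_ne_zero_iff hab)
  refine le_antisymm (iSup₂_le fun ℓ hℓ => ?_) (iSup₂_le fun J hJ => iSup₂_le ?_)
  -- The empty product `ℓ = 0` has no bar to witness it, but it contributes only the value `0` to
  -- the supremum.
  · rcases Nat.eq_zero_or_pos ℓ with rfl | hpos
    · exact zero_le
    · obtain ⟨p, l, hl⟩ := (hiff ⟨ℓ, hpos⟩).1 hℓ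
      refine le_iSup₂_of_le _ hl ?_
      exact le_iSup₂_of_le (⟨ℓ, hpos⟩ : ℕ+) ⟨p, l, rfl⟩ le_rfl
  · rintro ℓ ⟨p, l, rfl⟩
    exact le_iSup₂_of_le (f := fun (ℓ : ℕ) _ => (ℓ : ℕ∞)) (ℓ : ℕ) ((hiff ℓ).2 ⟨p, l, hJ⟩) le_rfl

end CupLength

end CupPersistence

end

theorem mainTheorem9 {K : Type v} [Field K] (X : ℝ ⥤ TopCat.{u}) :
    -- with q-tame cohomology and discrete critical values, the cup modules have barcodes
    ((∀ p : ℕ, (persistentCohomology K X p).IsQTame) →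
      _root_.IsDiscrete {t : ℝ | IsCriticalValue K X t} →
        ∀ ℓ p : ℕ+, Nonempty (persistentCupModule K X ℓ p).Barcode) ∧
    -- the persistent cup-length invariant is recovered from any choice of barcodes
    (∀ (B : ∀ ℓ p : ℕ+, (persistentCupModule K X ℓ p).Barcode)
      {a b : ℝ} (hab : a ≤ b),
        persistentCupLength K X hab =
          ⨆ (J : Set ℝ) (_ : Set.Icc a b ⊆ J), cupBarLength B J) ∧
    -- the values on the bars do not depend on the decompositions into interval modules
    (∀ B B' : ∀ ℓ p : ℕ+, (persistentCupModule K X ℓ p).Barcode,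
      cupBarLength B = cupBarLength B') :=
  ⟨nonempty_barcode_persistentCupModule, persistentCupLength_eq, cupBarLength_eq⟩
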